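/- **Setting.** A clock constraint over a finite set $C$ of clocks is a finite (possibly empty) conjunction of formulae $x\sim c$ with $x\in C$, $c\in\mathbb{N}$ and $\sim\,\in\{\le,\ge,>,<\}$. Let $\mathcal{A}=(L,\ell_{\mathsf{init}},C,\Sigma,I,E)$ be a timed automaton: $L$ is a finite set of locations, $\ell_{\mathsf{init}}\in L$, $C$ is a finite set of clocks containing a special clock $\gamma$, $\Sigma$ is a finite set of actions, $I$ assigns to each location a clock constraint over $C$ (its invariant), and $E$ is a finite set of edges $(\ell,g,a,D,\ell')$ with $\ell,\ell'\in L$, $g$ a clock constraint over $C$ (the guard), $a\in\Sigma$ and $D\subseteq C\setminus\{\gamma\}$. $\mathcal{A}$ is deterministic: two different edges with the same source and the same action never have guards satisfied by a common valuation. Let $p\colon L\to\mathbb{N}$ be a priority function. States are pairs $(\ell,v)\in L\times\mathbb{R}_{\ge0}^C$; the initial state is $s_{\mathsf{init}}=(\ell_{\mathsf{init}},\mathbf{0})$; moves are elements of $\mathbb{R}_{\ge0}\times(\Sigma\cup\{\bot\})$. There is a transition $(\ell,v)\xrightarrow{\delta,a}(\ell',v')$ with $a\in\Sigma$ iff for some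 edge $(\ell,g,a,D,\ell')\in E$ we have $v+\delta\models g$, $v+\delta\models I(\ell)$, $v'$ is $v+\delta$ with the clocks in $D$ reset to $0$, and $v'\models I(\ell')$; and $(\ell,v)\xrightarrow{\delta,\bot}(\ell,v+\delta)$ iff $v+\delta\models I(\ell)$. A (finite, possibly of length $0$, or infinite) path is a sequence $s_0m_0s_1m_1\dots$ of consecutive transitions; it is initial if $s_0=s_{\mathsf{init}}$. An infinite path is time-divergent if the values of $\gamma$ along it are unbounded. A set of states is reachable from $s$ if some finite path leads from $s$ to a state in the set; a state is reachable if it is reachable from $s_{\mathsf{init}}$. For $x\in C$ let $c_x$ be the largest constant to which $x$ is compared in guards and invariants of $\mathcal{A}$ ($0$ if there is none). Valuations $v,v'$ are clock-equivalent if (i) for all $x\in C$, $v(x)>c_x\iff v'(x)>c_x$; (ii) for all $x$ with $v(x)\le c_x$, $\lfloor v(x)\rfloor=\lfloor v'(x)\rfloor$; (iii) for all $x,y\in\{z\in C\mid v(z)\le c_z\}\cup\{\gamma\}$, $v(x)\in\mathbb{N}\iff v'(x)\in\mathbb{N}$, and $\mathsf{frac}(v(x))\le\mathsf{frac}(v(y))\iff\mathsf{frac}(v'(x))\le\mathsf{frac}(v'(y))$.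 $\mathsf{Reg}$ is the (finite) set of equivalence classes of valuations. States $(\ell,v)$ and $(\ell',v')$ are equivalent, written $\equiv_{\mathcal{A}}$, if $\ell=\ell'$ and $v,v'$ are clock-equivalent; $[s]$ is the class of the state $s$. For $\lambda\in\mathbb{N}$, a sequence of states $(\ell_0,v_0)(\ell_1,v_1)\dots$ is in $\mathsf{TGW}(p,\lambda)$ if for some $n$, $\min_{0\le j\le n}p(\ell_j)$ is even and $v_n(\gamma)-v_0(\gamma)<\lambda$; it is in $\mathsf{DFTW}(p,\lambda)$ if all its suffixes are in $\mathsf{TGW}(p,\lambda)$; it is in $\mathsf{FTW}(p,\lambda)$ if some suffix of it is in $\mathsf{DFTW}(p,\lambda)$; it is in $\mathsf{BTW}(p)$ if it is in $\mathsf{FTW}(p,\lambda)$ for some $\lambda\in\mathbb{N}$. A path belongs to one of these sets if its sequence of states does. **Theorem.** The following three statements are equivalent. 1. There exists a time-divergent initial path $\pi\notin\mathsf{BTW}(p)$. 2. There exists a time-divergent initial path $\pi\notin\mathsf{FTW}(p,\,2\cdot|L|\cdot|\mathsf{Reg}|+3)$. 3. There exist reachable states $s_1,s_2,s_2',s_3,s_4$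 such that $s_2\equiv_{\mathcal{A}}s_2'$; the value of $\gamma$ is an integer in exactly one of $s_3$ and $s_4$; there is a finite path $h$ from $s_1$ to $s_2'$ passing through $s_2$, $s_3$, $s_4$ in this order (possibly at the same position) such that for every non-empty prefix of $h$ the smallest priority of the locations occurring in it is odd; and the region $[s_1]$ is reachable from $s_2'$. -/

import Mathlib

open scoped NNReal

/-- The comparison operators allowed in clock constraints. -/
inductive ClockCmp
  | le | ge | gt | lt

/-- `r.Holds t c` is the comparison `t ∼ c`, for a clock value `t` and a constant `c ∈ ℕ`. -/
def ClockCmp.Holds : ClockCmp → ℝ≥0 → ℕ → Prop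
  | .le, t, c => t ≤ (c : ℝ≥0)
  | .ge, t, c => (c : ℝ≥0) ≤ t
  | .gt, t, c => (c : ℝ≥0) < t
  | .lt, t, c => t < (c : ℝ≥0)

/-- Clock constraints over `C`: finite conjunctions of formulae `x ∼ c`
(`tt` is the empty conjunction). -/
inductive ClockConstraint (C : Type*)
  | tt : ClockConstraint C
  | atom (x : C) (r : ClockCmp) (c : ℕ) : ClockConstraint C
  | conj (g h : ClockConstraint C) : ClockConstraint C

/-- Satisfaction of a clock constraint by a clock valuation. -/
def ClockConstraint.Sat {C : Type*} (v : C → ℝ≥0) : ClockConstraint C → Prop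
  | .tt => True
  | .atom x r c => r.Holds (v x) c
  | .conj g h => g.Sat v ∧ h.Sat v

open Classical in
/-- The largest constant to which the clock `x` is compared in a constraint (`0` if none). -/
noncomputable def ClockConstraint.maxConst {C : Type*} (x : C) : ClockConstraint C → ℕ
  | .tt => 0
  | .atom y _ c => if y = x then c else 0
  | .conj g h => max (g.maxConst x) (h.maxConst x)

/-- Edges of a timed automaton: source, guard, action, set of clocks to reset, target. -/
structure TimedEdge (L C A : Type*) where
  src : L
  guard : ClockConstraint C
  act : A
  resets : Set C
  tgt : L

/-- A deterministic timed automaton with locations `L`, clocks `C`, actions `A`.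
Finiteness of `L`, `C` and `A` is assumed separately. -/
structure TimedAutomaton (L C A : Type*) where
  /-- the initial location -/
  init : L
  /-- the special clock keeping track of the total time elapsed -/
  γ : C
  /-- the invariants -/
  inv : L → ClockConstraint C
  /-- the finite edge relation -/
  edges : Finset (TimedEdge L C A)
  /-- the special clock is never reset -/
  γ_notMem_resets : ∀ e ∈ edges, γ ∉ e.resets
  /-- two different edges leaving the same location with the same action have
  guards that are not jointly satisfiable -/
  deterministic : ∀ e₁ ∈ edges, ∀ e₂ ∈ edges, e₁ ≠ e₂ → e₁.src = e₂.src → e₁.act = e₂.act →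
    ¬ ∃ v : C → ℝ≥0, e₁.guard.Sat v ∧ e₂.guard.Sat v

/-- States: pairs of a location and a clock valuation. -/
abbrev TimedState (L C : Type*) := L × (C → ℝ≥0)

/-- Moves: a delay and an action, or `none` in place of the symbol `⊥` of delay moves. -/
abbrev TimedMove (A : Type*) := ℝ≥0 × Option A

namespace TimedAutomaton

variable {L C A : Type*}

/-- The valuation `v + δ`. -/
def delayed (v : C → ℝ≥0) (δ : ℝ≥0) : C → ℝ≥0 := fun x => v x + δ

open Classical in
/-- The valuation `reset_D(v)`. -/
noncomputable def reset (D : Set C) (v : C → ℝ≥0) : C → ℝ≥0 := fun x => if x ∈ D then 0 else v x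

/-- The transition relation of the transition system of a timed automaton. -/
def Transition (𝒜 : TimedAutomaton L C A) (s : TimedState L C) (m : TimedMove A)
    (s' : TimedState L C) : Prop :=
  match m with
  | (δ, some a) => ∃ e ∈ 𝒜.edges, e.src = s.1 ∧ e.act = a ∧ e.tgt = s'.1 ∧
      e.guard.Sat (delayed s.2 δ) ∧ s'.2 = reset e.resets (delayed s.2 δ) ∧
      (𝒜.inv s.1).Sat (delayed s.2 δ) ∧ (𝒜.inv s'.1).Sat s'.2
  | (δ, none) => s' = (s.1, delayed s.2 δ) ∧ (𝒜.inv s.1).Sat (delayed s.2 δ)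

/-- The initial state: the initial location with the zero valuation. -/
def initState (𝒜 : TimedAutomaton L C A) : TimedState L C := (𝒜.init, fun _ => 0)

/-- Infinite paths `s₀ m₀ s₁ m₁ …`. -/
structure InfPath (𝒜 : TimedAutomaton L C A) where
  state : ℕ → TimedState L C
  move : ℕ → TimedMove A
  step : ∀ j, 𝒜.Transition (state j) (move j) (state (j + 1))

/-- Finite paths `s₀ m₀ s₁ … m_{n-1} s_n`, where `n = length`. -/
structure FinPath (𝒜 : TimedAutomaton L C A) where
  length : ℕ
  state : Fin (length + 1) → TimedState L C
  move : Fin length → TimedMove A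
  step : ∀ j : Fin length, 𝒜.Transition (state j.castSucc) (move j) (state j.succ)

/-- An infinite path is initial if it starts in the initial state. -/
def InfPath.IsInitial {𝒜 : TimedAutomaton L C A} (π : 𝒜.InfPath) : Prop :=
  π.state 0 = 𝒜.initState

/-- An infinite path is time-divergent if the values of `γ` along it are unbounded. -/
def InfPath.TimeDivergent {𝒜 : TimedAutomaton L C A} (π : 𝒜.InfPath) : Prop :=
  ¬ BddAbove (Set.range fun j => (π.state j).2 𝒜.γ)

/-- The set of states `T` is reachable from the state `s`. -/
def SetReachableFrom (𝒜 : TimedAutomaton L C A) (T : Set (TimedState L C))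
    (s : TimedState L C) : Prop :=
  ∃ h : 𝒜.FinPath, h.state 0 = s ∧ h.state (Fin.last h.length) ∈ T

/-- The state `s` is reachable (from the initial state). -/
def Reachable (𝒜 : TimedAutomaton L C A) (s : TimedState L C) : Prop :=
  𝒜.SetReachableFrom {s} 𝒜.initState

/-- `c_x`: the largest constant to which `x` is compared in guards and invariants
(`0` if there is none). -/
noncomputable def maxConst [Fintype L] (𝒜 : TimedAutomaton L C A) (x : C) : ℕ :=
  max (𝒜.edges.sup fun e => e.guard.maxConst x)
    (Finset.univ.sup fun l : L => (𝒜.inv l).maxConst x)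

/-- The value `t` is an integer. -/
def IsIntegerValue (t : ℝ≥0) : Prop := ∃ k : ℕ, t = k

/-- Clock-equivalence of valuations. -/
def ClockEquiv [Fintype L] (𝒜 : TimedAutomaton L C A) (v w : C → ℝ≥0) : Prop :=
  (∀ x, (𝒜.maxConst x : ℝ≥0) < v x ↔ (𝒜.maxConst x : ℝ≥0) < w x) ∧
  (∀ x, v x ≤ 𝒜.maxConst x → ⌊v x⌋₊ = ⌊w x⌋₊) ∧
  (∀ x y, (v x ≤ 𝒜.maxConst x ∨ x = 𝒜.γ) → (v y ≤ 𝒜.maxConst y ∨ y = 𝒜.γ) →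
    (IsIntegerValue (v x) ↔ IsIntegerValue (w x)) ∧
    (Int.fract (v x : ℝ) ≤ Int.fract (v y : ℝ) ↔ Int.fract (w x : ℝ) ≤ Int.fract (w y : ℝ)))

theorem ClockEquiv.le_iff [Fintype L] {𝒜 : TimedAutomaton L C A} {v w : C → ℝ≥0}
    (h : 𝒜.ClockEquiv v w) (x : C) : v x ≤ 𝒜.maxConst x ↔ w x ≤ 𝒜.maxConst x := by
  rw [← not_lt, ← not_lt, h.1 x]

theorem ClockEquiv.equivalence [Fintype L] (𝒜 : TimedAutomaton L C A) :
    Equivalence 𝒜.ClockEquiv where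
  refl v := ⟨fun _ => Iff.rfl, fun _ _ => rfl, fun _ _ _ _ => ⟨Iff.rfl, Iff.rfl⟩⟩
  symm {v w} h := by
    refine ⟨fun x => (h.1 x).symm, fun x hx => (h.2.1 x ((h.le_iff x).2 hx)).symm, ?_⟩
    intro x y hx hy
    have := h.2.2 x y (hx.imp_left (h.le_iff x).2) (hy.imp_left (h.le_iff y).2)
    exact ⟨this.1.symm, this.2.symm⟩
  trans {u v w} h k := by
    refine ⟨fun x => (h.1 x).trans (k.1 x),
      fun x hx => (h.2.1 x hx).trans (k.2.1 x ((h.le_iff x).1 hx)), ?_⟩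
    intro x y hx hy
    have h1 := h.2.2 x y hx hy
    have h2 := k.2.2 x y (hx.imp_left (h.le_iff x).1) (hy.imp_left (h.le_iff y).1)
    exact ⟨h1.1.trans h2.1, h1.2.trans h2.2⟩

/-- Clock-equivalence as a setoid. -/
def clockSetoid [Fintype L] (𝒜 : TimedAutomaton L C A) : Setoid (C → ℝ≥0) :=
  ⟨𝒜.ClockEquiv, ClockEquiv.equivalence 𝒜⟩

/-- `Reg`: the type of all clock regions, i.e. classes of clock-equivalence. -/
def Reg [Fintype L] (𝒜 : TimedAutomaton L C A) := Quotient 𝒜.clockSetoid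

/-- State-equivalence. -/
def StateEquiv [Fintype L] (𝒜 : TimedAutomaton L C A) (s t : TimedState L C) : Prop :=
  s.1 = t.1 ∧ 𝒜.ClockEquiv s.2 t.2

/-- The state region `[s]`. -/
def stateRegion [Fintype L] (𝒜 : TimedAutomaton L C A) (s : TimedState L C) :
    Set (TimedState L C) := {t | 𝒜.StateEquiv t s}

/-- The smallest priority among the states of indices at most `i` in a finite or infinite
sequence of states. -/
def minPriority (p : L → ℕ) {ι : Type*} [LinearOrder ι] [LocallyFiniteOrderBot ι]
    (s : ι → TimedState L C) (i : ι) : ℕ :=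
  (Finset.Iic i).inf' Finset.nonempty_Iic fun j => p (s j).1

/-- The timed good window objective `TGW(p, lam)`. -/
def TGW (𝒜 : TimedAutomaton L C A) (p : L → ℕ) (lam : ℕ) : Set (ℕ → TimedState L C) :=
  {s | ∃ n, minPriority p s n % 2 = 0 ∧ ((s n).2 𝒜.γ : ℝ) - ((s 0).2 𝒜.γ : ℝ) < (lam : ℝ)}

/-- The direct fixed timed window objective `DFTW(p, lam)`. -/
def DFTW (𝒜 : TimedAutomaton L C A) (p : L → ℕ) (lam : ℕ) : Set (ℕ → TimedState L C) :=
  {s | ∀ n, (fun k => s (n + k)) ∈ 𝒜.TGW p lam}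

/-- The fixed timed window objective `FTW(p, lam)`. -/
def FTW (𝒜 : TimedAutomaton L C A) (p : L → ℕ) (lam : ℕ) : Set (ℕ → TimedState L C) :=
  {s | ∃ n, (fun k => s (n + k)) ∈ 𝒜.DFTW p lam}

/-- The bounded timed window objective `BTW(p)`. -/
def BTW (𝒜 : TimedAutomaton L C A) (p : L → ℕ) : Set (ℕ → TimedState L C) :=
  {s | ∃ lam : ℕ, s ∈ 𝒜.FTW p lam}

end TimedAutomaton

/-!
The implication from the bounded to the fixed objective is immediate, since `BTW p` contains every
`FTW p lam`. The other two implications rest on the fact that state-equivalence is a time-abstract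
bisimulation of finite index (`StateEquiv.exists_step`, `finite_reg`): a delay `δ` from a valuation
is matched, from an equivalent one, by a delay with the same integer part whose fractional part is
in the same position relative to the fractional parts of the clocks (`ClockEquiv.exists_delayed`).

*From a long bad window to a loop.* A time-divergent path outside of `FTW p lam` has infinitely many
indices at which no good window of length less than `lam` starts, and infinitely many of these
indices lie in one state region (`InfPath.exists_isRecurrentBad`). Within one such bad window,
delays are split so that `γ` takes all integer values and all half-integer values in between. The
split delays remain allowed because invariants are convex, and they change no smallest priority
because they repeat locations (`IsRecurrentBad.exists_insert`). As soon as the window contains more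
integer times than there are state regions, two of them are reached in equivalent states, with a
half-integer time in between (`IsRecurrentBad.exists_loop`). The path later comes back to the region
where the window started.

*From a loop to an unbounded path.* By bisimulation, the loop can be taken any number of times from
any state equivalent to the given one. In each turn `γ` changes between integer and non-integer
values and is back to the initial kind at the end, so that it passes an integer; and no turn
visits new locations, so that all prefixes keep an odd smallest priority (`exists_run_of_loop`).
Taking the loop more than `r` times in the `r`-th round, and returning to the starting region after
each round, yields a time-divergent path with bad windows of unbounded length
(`exists_timeDivergent_notMem_BTW`).
-/

namespace TimedAutomaton

/-! ### Integer and fractional parts -/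

theorem natFloor_add_fract (t : ℝ≥0) : (⌊t⌋₊ : ℝ) + Int.fract (t : ℝ) = t := by
  have h : ⌊(t : ℝ)⌋ = (⌊t⌋₊ : ℤ) := by
    rw [Int.floor_eq_iff]
    have h1 : (⌊t⌋₊ : ℝ≥0) ≤ t := Nat.floor_le zero_le
    exact_mod_cast And.intro h1 (Nat.lt_floor_add_one t)
  rw [Int.fract, h]
  simp

theorem isIntegerValue_iff_fract (t : ℝ≥0) : IsIntegerValue t ↔ Int.fract (t : ℝ) = 0 := by
  constructor
  · rintro ⟨k, rfl⟩
    simp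
  · intro h
    refine ⟨⌊t⌋₊, NNReal.coe_injective ?_⟩
    have := natFloor_add_fract t
    rw [h, add_zero] at this
    simpa using this.symm

theorem natFloor_eq_and_fract_eq {t : ℝ≥0} {n : ℕ} {f : ℝ} (h : (t : ℝ) = n + f) (h0 : 0 ≤ f)
    (h1 : f < 1) : ⌊t⌋₊ = n ∧ Int.fract (t : ℝ) = f := by
  constructor
  · rw [Nat.floor_eq_iff zero_le, ← NNReal.coe_le_coe, ← NNReal.coe_lt_coe]
    push_cast
    constructor <;> linarith
  · rw [h, Int.fract_natCast_add, Int.fract_eq_self.2 ⟨h0, h1⟩]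

theorem natFloor_fract_add_of_lt {s δ : ℝ≥0} (h : Int.fract (δ : ℝ) + Int.fract (s : ℝ) < 1) :
    ⌊s + δ⌋₊ = ⌊s⌋₊ + ⌊δ⌋₊ ∧
      Int.fract ((s + δ : ℝ≥0) : ℝ) = Int.fract (δ : ℝ) + Int.fract (s : ℝ) := by
  apply natFloor_eq_and_fract_eq _ (add_nonneg (Int.fract_nonneg _) (Int.fract_nonneg _)) h
  have h1 := natFloor_add_fract s
  have h2 := natFloor_add_fract δ
  push_cast
  linarith

theorem natFloor_fract_add_of_ge {s δ : ℝ≥0} (h : ¬ Int.fract (δ : ℝ) + Int.fract (s : ℝ) < 1) :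
    ⌊s + δ⌋₊ = ⌊s⌋₊ + ⌊δ⌋₊ + 1 ∧
      Int.fract ((s + δ : ℝ≥0) : ℝ) = Int.fract (δ : ℝ) + Int.fract (s : ℝ) - 1 := by
  have h1 := natFloor_add_fract s
  have h2 := natFloor_add_fract δ
  have h3 := Int.fract_lt_one (s : ℝ)
  have h4 := Int.fract_lt_one (δ : ℝ)
  refine natFloor_eq_and_fract_eq ?_ (by linarith) (by linarith)
  push_cast
  linarith

theorem natCast_lt_iff_floor (c : ℕ) (t : ℝ≥0) :
    (c : ℝ≥0) < t ↔ c < ⌊t⌋₊ ∨ (c = ⌊t⌋₊ ∧ ¬ IsIntegerValue t) := by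
  rw [isIntegerValue_iff_fract, ← NNReal.coe_lt_coe, NNReal.coe_natCast]
  have h := natFloor_add_fract t
  have h0 := Int.fract_nonneg (t : ℝ)
  have h1 := Int.fract_lt_one (t : ℝ)
  rcases lt_trichotomy c ⌊t⌋₊ with hc | hc | hc
  · have : (c : ℝ) < ⌊t⌋₊ := by exact_mod_cast hc
    exact ⟨fun _ => Or.inl hc, fun _ => by linarith⟩
  · have hc' : (c : ℝ) = ⌊t⌋₊ := by exact_mod_cast hc
    constructor
    · intro hlt
      exact Or.inr ⟨hc, fun hz => by linarith⟩
    · rintro (hlt | ⟨-, hz⟩)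
      · omega
      · have := lt_of_le_of_ne h0 (Ne.symm hz)
        linarith
  · have : (⌊t⌋₊ : ℝ) + 1 ≤ c := by exact_mod_cast hc
    constructor
    · intro hlt
      linarith
    · rintro (hlt | ⟨hlt, -⟩) <;> omega

/-- A finite partial map preserving the order and the zeros of fractional parts extends to one
more point: the offset `d` can be matched by an offset `d'` that lies in the same way relative to
the complements `1 - g x` as `d` does to `1 - f x`. -/
theorem exists_offset {X : Type*} [Finite X] (S : Set X) (f g : X → ℝ)
    (hg0 : ∀ x, 0 ≤ g x) (hg1 : ∀ x, g x < 1)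
    (hle : ∀ x ∈ S, ∀ y ∈ S, f x ≤ f y ↔ g x ≤ g y)
    (hz : ∀ x ∈ S, f x = 0 ↔ g x = 0) (hf1 : ∀ x, f x < 1) {d : ℝ} (hd0 : 0 ≤ d) (hd1 : d < 1) :
    ∃ d' : ℝ, 0 ≤ d' ∧ d' < 1 ∧ (d = 0 ↔ d' = 0) ∧
      ∀ x ∈ S, (d + f x < 1 ↔ d' + g x < 1) ∧ (d + f x ≤ 1 ↔ d' + g x ≤ 1) := by
  classical
  have := Fintype.ofFinite X
  rcases hd0.eq_or_lt with rfl | hd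
  · refine ⟨0, le_rfl, zero_lt_one, Iff.rfl, fun x _ => ?_⟩
    have h1 := hf1 x
    have h2 := hg1 x
    constructor <;> constructor <;> intro <;> linarith
  by_cases htie : ∃ x ∈ S, d + f x = 1
  · obtain ⟨x, hx, hdx⟩ := htie
    have hgx : g x ≠ 0 := fun h => by
      have := (hz x hx).2 h
      linarith
    have hgx' : 0 < g x := lt_of_le_of_ne (hg0 x) hgx.symm
    have h1 := hg1 x
    refine ⟨1 - g x, by linarith, by linarith, ⟨fun h => by linarith, fun h => by linarith⟩, ?_⟩
    intro y hy
    constructor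
    · rw [show d + f y < 1 ↔ ¬ f x ≤ f y by rw [not_le]; constructor <;> intro <;> linarith,
        hle x hx y hy, not_le]
      constructor <;> intro <;> linarith
    · rw [show d + f y ≤ 1 ↔ f y ≤ f x by constructor <;> intro <;> linarith, hle y hy x hx]
      constructor <;> intro <;> linarith
  · push Not at htie
    let lo : Finset ℝ := insert 0 ((Finset.univ.filter fun x => x ∈ S ∧ 1 < d + f x).image
      fun x => 1 - g x)
    let hi : Finset ℝ := insert 1 ((Finset.univ.filter fun x => x ∈ S ∧ d + f x < 1).image
      fun x => 1 - g x)
    obtain ⟨e, hlo, hhi⟩ : ∃ e, (∀ a ∈ lo, a < e) ∧ ∀ b ∈ hi, e < b := by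
      refine Order.exists_between_finsets lo hi ?_
      simp only [lo, hi, Finset.mem_insert, Finset.mem_image, Finset.mem_filter, Finset.mem_univ,
        true_and]
      rintro a (rfl | ⟨x, ⟨hx, hdx⟩, rfl⟩) b (rfl | ⟨y, ⟨hy, hdy⟩, rfl⟩)
      · exact zero_lt_one
      · linarith [hg1 y]
      · have hgx : g x ≠ 0 := fun h => by
          have := (hz x hx).2 h
          linarith
        linarith [lt_of_le_of_ne (hg0 x) hgx.symm]
      · have : ¬ g x ≤ g y := by
          rw [← hle x hx y hy]
          intro h
          linarith
        linarith
    have he0 : 0 < e := hlo 0 (by simp [lo])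
    have he1 : e < 1 := hhi 1 (by simp [hi])
    refine ⟨e, he0.le, he1, ⟨fun h => absurd h hd.ne', fun h => absurd h he0.ne'⟩, ?_⟩
    intro x hx
    rcases lt_or_gt_of_ne (htie x hx) with h | h
    · have := hhi (1 - g x) (Finset.mem_insert_of_mem (Finset.mem_image_of_mem _ (by simp [hx, h])))
      constructor <;> constructor <;> intro <;> linarith
    · have := hlo (1 - g x) (Finset.mem_insert_of_mem (Finset.mem_image_of_mem _ (by simp [hx, h])))
      constructor <;> constructor <;> intro <;> linarith

/-! ### Clock-equivalence is a time-abstract bisimulation -/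

section Bisimulation

variable {L C A : Type*} [Fintype L]

theorem ClockEquiv.symm {𝒜 : TimedAutomaton L C A} {v w : C → ℝ≥0} (h : 𝒜.ClockEquiv v w) :
    𝒜.ClockEquiv w v :=
  (ClockEquiv.equivalence 𝒜).symm h

theorem ClockEquiv.isIntegerValue_γ_iff {𝒜 : TimedAutomaton L C A} {v w : C → ℝ≥0}
    (h : 𝒜.ClockEquiv v w) : IsIntegerValue (v 𝒜.γ) ↔ IsIntegerValue (w 𝒜.γ) :=
  (h.2.2 𝒜.γ 𝒜.γ (Or.inr rfl) (Or.inr rfl)).1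

/-- Every delay from `v` is matched by a delay with the same integer part from any equivalent
valuation `w`; only the fractional part of the delay has to be adapted. -/
theorem ClockEquiv.exists_delayed [Finite C] {𝒜 : TimedAutomaton L C A} {v w : C → ℝ≥0}
    (h : 𝒜.ClockEquiv v w) (δ : ℝ≥0) :
    ∃ δ' : ℝ≥0, 𝒜.ClockEquiv (delayed v δ) (delayed w δ') := by
  obtain ⟨d', hd0, hd1, hz, hX⟩ := exists_offset
    {x | v x ≤ 𝒜.maxConst x ∨ x = 𝒜.γ} (fun x => Int.fract (v x : ℝ))
    (fun x => Int.fract (w x : ℝ)) (fun x => Int.fract_nonneg _) (fun x => Int.fract_lt_one _)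
    (fun x hx y hy => (h.2.2 x y hx hy).2)
    (fun x hx => by
      have := (h.2.2 x x hx hx).1
      rwa [isIntegerValue_iff_fract, isIntegerValue_iff_fract] at this)
    (fun x => Int.fract_lt_one _) (Int.fract_nonneg (δ : ℝ)) (Int.fract_lt_one (δ : ℝ))
  refine ⟨⌊δ⌋₊ + d'.toNNReal, ?_⟩
  set δ' : ℝ≥0 := ⌊δ⌋₊ + d'.toNNReal with hδ'
  obtain ⟨hfl, hfr⟩ := natFloor_eq_and_fract_eq (t := δ') (n := ⌊δ⌋₊) (f := d')
    (by rw [hδ', NNReal.coe_add, NNReal.coe_natCast, Real.coe_toNNReal d' hd0]) hd0 hd1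
  rw [← hfr] at hz hX
  have hfloor : ∀ x, v x ≤ 𝒜.maxConst x → ⌊v x + δ⌋₊ = ⌊w x + δ'⌋₊ := by
    intro x hx
    have h1 := (hX x (Or.inl hx)).1
    have h2 := h.2.1 x hx
    by_cases hlt : Int.fract (δ : ℝ) + Int.fract (v x : ℝ) < 1
    · rw [(natFloor_fract_add_of_lt hlt).1, (natFloor_fract_add_of_lt (h1.1 hlt)).1, hfl, h2]
    · rw [(natFloor_fract_add_of_ge hlt).1, (natFloor_fract_add_of_ge (mt h1.2 hlt)).1, hfl, h2]
  have hint : ∀ x, v x ≤ 𝒜.maxConst x ∨ x = 𝒜.γ →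
      (IsIntegerValue (v x + δ) ↔ IsIntegerValue (w x + δ')) := by
    intro x hx
    have h1 := hX x hx
    have h2 := (h.2.2 x x hx hx).1
    rw [isIntegerValue_iff_fract, isIntegerValue_iff_fract] at h2 ⊢
    have p1 := Int.fract_nonneg (δ : ℝ)
    have p2 := Int.fract_nonneg (v x : ℝ)
    have p3 := Int.fract_nonneg (δ' : ℝ)
    have p4 := Int.fract_nonneg (w x : ℝ)
    by_cases hlt : Int.fract (δ : ℝ) + Int.fract (v x : ℝ) < 1
    · rw [(natFloor_fract_add_of_lt hlt).2, (natFloor_fract_add_of_lt (h1.1.1 hlt)).2,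
        add_eq_zero_iff_of_nonneg p1 p2, add_eq_zero_iff_of_nonneg p3 p4, hz, h2]
    · rw [(natFloor_fract_add_of_ge hlt).2, (natFloor_fract_add_of_ge (mt h1.1.2 hlt)).2]
      have hlt' := mt h1.1.2 hlt
      constructor
      · intro he
        have := h1.2.1 (by linarith)
        linarith
      · intro he
        have := h1.2.2 (by linarith)
        linarith
  refine ⟨fun x => ?_, fun x hx => ?_, fun x y hx hy => ?_⟩
  · change _ < v x + δ ↔ _ < w x + δ'
    by_cases hx : v x ≤ 𝒜.maxConst x
    · rw [natCast_lt_iff_floor, natCast_lt_iff_floor, hfloor x hx, hint x (Or.inl hx)]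
    · have h1 := lt_of_not_ge hx
      have h2 := (h.1 x).1 h1
      exact ⟨fun _ => h2.trans_le le_self_add, fun _ => h1.trans_le le_self_add⟩
  · exact hfloor x (le_self_add.trans hx)
  · replace hx : v x ≤ 𝒜.maxConst x ∨ x = 𝒜.γ := hx.imp_left le_self_add.trans
    replace hy : v y ≤ 𝒜.maxConst y ∨ y = 𝒜.γ := hy.imp_left le_self_add.trans
    refine ⟨hint x hx, ?_⟩
    change Int.fract ((v x + δ : ℝ≥0) : ℝ) ≤ Int.fract ((v y + δ : ℝ≥0) : ℝ) ↔
      Int.fract ((w x + δ' : ℝ≥0) : ℝ) ≤ Int.fract ((w y + δ' : ℝ≥0) : ℝ)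
    have hxy := (h.2.2 x y hx hy).2
    have hx1 := (hX x hx).1
    have hy1 := (hX y hy).1
    have vx1 := Int.fract_lt_one (v x : ℝ)
    have vy1 := Int.fract_lt_one (v y : ℝ)
    have wx1 := Int.fract_lt_one (w x : ℝ)
    have wy1 := Int.fract_lt_one (w y : ℝ)
    have vx0 := Int.fract_nonneg (v x : ℝ)
    have vy0 := Int.fract_nonneg (v y : ℝ)
    have wx0 := Int.fract_nonneg (w x : ℝ)
    have wy0 := Int.fract_nonneg (w y : ℝ)
    -- A clock that passes an integer ends up below every clock that does not.
    by_cases hx2 : Int.fract (δ : ℝ) + Int.fract (v x : ℝ) < 1 <;>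
    by_cases hy2 : Int.fract (δ : ℝ) + Int.fract (v y : ℝ) < 1
    · rw [(natFloor_fract_add_of_lt hx2).2, (natFloor_fract_add_of_lt hy2).2,
        (natFloor_fract_add_of_lt (hx1.1 hx2)).2, (natFloor_fract_add_of_lt (hy1.1 hy2)).2,
        add_le_add_iff_left, add_le_add_iff_left, hxy]
    · rw [(natFloor_fract_add_of_lt hx2).2, (natFloor_fract_add_of_ge hy2).2,
        (natFloor_fract_add_of_lt (hx1.1 hx2)).2, (natFloor_fract_add_of_ge (mt hy1.2 hy2)).2]
      constructor <;> intro <;> linarith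
    · rw [(natFloor_fract_add_of_ge hx2).2, (natFloor_fract_add_of_lt hy2).2,
        (natFloor_fract_add_of_ge (mt hx1.2 hx2)).2, (natFloor_fract_add_of_lt (hy1.1 hy2)).2]
      constructor <;> intro <;> linarith
    · rw [(natFloor_fract_add_of_ge hx2).2, (natFloor_fract_add_of_ge hy2).2,
        (natFloor_fract_add_of_ge (mt hx1.2 hx2)).2, (natFloor_fract_add_of_ge (mt hy1.2 hy2)).2,
        sub_le_sub_iff_right, sub_le_sub_iff_right, add_le_add_iff_left, add_le_add_iff_left, hxy]

theorem ClockEquiv.reset {𝒜 : TimedAutomaton L C A} {v w : C → ℝ≥0} (h : 𝒜.ClockEquiv v w)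
    (D : Set C) : 𝒜.ClockEquiv (reset D v) (reset D w) := by
  have hz : ∀ x, x ∉ D → v x ≤ 𝒜.maxConst x ∨ x = 𝒜.γ →
      (Int.fract (v x : ℝ) ≤ 0 ↔ Int.fract (w x : ℝ) ≤ 0) := by
    intro x _ hx
    have := (h.2.2 x x hx hx).1
    rw [isIntegerValue_iff_fract, isIntegerValue_iff_fract] at this
    rwa [(Int.fract_nonneg _).ge_iff_eq', (Int.fract_nonneg _).ge_iff_eq']
  refine ⟨fun x => ?_, fun x => ?_, fun x y => ?_⟩
  · by_cases hx : x ∈ D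
    · simp [TimedAutomaton.reset, hx]
    · simpa [TimedAutomaton.reset, hx] using h.1 x
  · by_cases hx : x ∈ D
    · simp [TimedAutomaton.reset, hx]
    · simpa [TimedAutomaton.reset, hx] using h.2.1 x
  · by_cases hx : x ∈ D <;> by_cases hy : y ∈ D <;>
      simp only [TimedAutomaton.reset, hx, hy, if_true, if_false]
    · simp
    · simp [Int.fract_nonneg]
    · intro hx' _
      refine ⟨(h.2.2 x x hx' hx').1, ?_⟩
      simpa using hz x hx hx'
    · exact h.2.2 x y

theorem ClockEquiv.sat_iff {𝒜 : TimedAutomaton L C A} {v w : C → ℝ≥0} (h : 𝒜.ClockEquiv v w)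
    (g : ClockConstraint C) (hg : ∀ x, g.maxConst x ≤ 𝒜.maxConst x) : g.Sat v ↔ g.Sat w := by
  induction g with
  | tt => exact Iff.rfl
  | conj g₁ g₂ ih₁ ih₂ =>
    exact and_congr (ih₁ fun x => (le_max_left _ _).trans (hg x))
      (ih₂ fun x => (le_max_right _ _).trans (hg x))
  | atom x r c =>
    have hc : c ≤ 𝒜.maxConst x := by simpa [ClockConstraint.maxConst] using hg x
    have hlt : (c : ℝ≥0) < v x ↔ (c : ℝ≥0) < w x := by
      by_cases hx : v x ≤ 𝒜.maxConst x
      · rw [natCast_lt_iff_floor, natCast_lt_iff_floor, h.2.1 x hx,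
          (h.2.2 x x (Or.inl hx) (Or.inl hx)).1]
      · have hx' := lt_of_not_ge hx
        have hc' : (c : ℝ≥0) ≤ 𝒜.maxConst x := by exact_mod_cast hc
        exact ⟨fun _ => hc'.trans_lt ((h.1 x).1 hx'), fun _ => hc'.trans_lt hx'⟩
    have hgt : v x < (c : ℝ≥0) ↔ w x < (c : ℝ≥0) := by
      by_cases hx : v x ≤ 𝒜.maxConst x
      · rw [← Nat.floor_lt zero_le, ← Nat.floor_lt zero_le, h.2.1 x hx]
      · have hx' := lt_of_not_ge hx
        have hc' : (c : ℝ≥0) ≤ 𝒜.maxConst x := by exact_mod_cast hc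
        exact ⟨fun h1 => absurd h1 (hc'.trans hx'.le).not_gt,
          fun h1 => absurd h1 (hc'.trans ((h.1 x).1 hx').le).not_gt⟩
    cases r
    · exact not_lt.symm.trans ((not_congr hlt).trans not_lt)
    · exact not_lt.symm.trans ((not_congr hgt).trans not_lt)
    · exact hlt
    · exact hgt

theorem guard_maxConst_le (𝒜 : TimedAutomaton L C A) {e : TimedEdge L C A} (he : e ∈ 𝒜.edges)
    (x : C) : e.guard.maxConst x ≤ 𝒜.maxConst x :=
  (Finset.le_sup (f := fun e : TimedEdge L C A => e.guard.maxConst x) he).trans (le_max_left _ _)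

theorem inv_maxConst_le (𝒜 : TimedAutomaton L C A) (l : L) (x : C) :
    (𝒜.inv l).maxConst x ≤ 𝒜.maxConst x :=
  (Finset.le_sup (f := fun l : L => (𝒜.inv l).maxConst x) (Finset.mem_univ l)).trans
    (le_max_right _ _)

theorem StateEquiv.refl (𝒜 : TimedAutomaton L C A) (s : TimedState L C) : 𝒜.StateEquiv s s :=
  ⟨rfl, (ClockEquiv.equivalence 𝒜).refl _⟩

theorem StateEquiv.symm {𝒜 : TimedAutomaton L C A} {s t : TimedState L C}
    (h : 𝒜.StateEquiv s t) : 𝒜.StateEquiv t s :=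
  ⟨h.1.symm, h.2.symm⟩

theorem StateEquiv.trans {𝒜 : TimedAutomaton L C A} {s t u : TimedState L C}
    (h : 𝒜.StateEquiv s t) (k : 𝒜.StateEquiv t u) : 𝒜.StateEquiv s u :=
  ⟨h.1.trans k.1, (ClockEquiv.equivalence 𝒜).trans h.2 k.2⟩

/-- `𝒜.Step s s'`: some move leads from `s` to `s'`. -/
def Step {L C A : Type*} (𝒜 : TimedAutomaton L C A) (s s' : TimedState L C) : Prop :=
  ∃ m, 𝒜.Transition s m s'

theorem StateEquiv.exists_step [Finite C] {𝒜 : TimedAutomaton L C A} {s s' t : TimedState L C}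
    (h : 𝒜.StateEquiv s t) (hs : 𝒜.Step s s') : ∃ t', 𝒜.Step t t' ∧ 𝒜.StateEquiv s' t' := by
  obtain ⟨⟨δ, a⟩, hs⟩ := hs
  obtain ⟨hl, hv⟩ := h
  obtain ⟨δ', hδ⟩ := hv.exists_delayed δ
  have hinv := hδ.sat_iff (𝒜.inv s.1) (𝒜.inv_maxConst_le s.1)
  cases a with
  | none =>
    obtain ⟨rfl, h2⟩ := hs
    exact ⟨(t.1, delayed t.2 δ'), ⟨(δ', none), rfl, hl ▸ hinv.1 h2⟩, hl, hδ⟩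
  | some a =>
    obtain ⟨e, he, hsrc, hact, htgt, hguard, hreset, hi, hi'⟩ := hs
    have hR := hδ.reset e.resets
    refine ⟨(s'.1, TimedAutomaton.reset e.resets (delayed t.2 δ')),
      ⟨(δ', some a), e, he, hsrc.trans hl, hact, htgt,
        (hδ.sat_iff _ (𝒜.guard_maxConst_le he)).1 hguard, rfl, hl ▸ hinv.1 hi, ?_⟩, rfl, ?_⟩
    · rw [hreset] at hi'
      exact (hR.sat_iff _ (𝒜.inv_maxConst_le _)).1 hi'
    · rw [hreset]
      exact hR

/-- There are finitely many clock regions: the region of `v` is determined by which clocks exceed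
their largest constant, the integer parts of the others, and the pattern of integer values and of
comparisons between fractional parts. -/
theorem finite_reg [Finite C] (𝒜 : TimedAutomaton L C A) : Finite 𝒜.Reg := by
  classical
  let code : (C → ℝ≥0) →
      ((x : C) → Fin (𝒜.maxConst x + 2)) × (C → Prop) × (C → C → Prop) := fun v =>
    (fun x => if h : v x ≤ 𝒜.maxConst x then
        ⟨⌊v x⌋₊, by
          have := Nat.floor_le_of_le h
          omega⟩ else Fin.last _,
      fun x => IsIntegerValue (v x), fun x y => Int.fract (v x : ℝ) ≤ Int.fract (v y : ℝ))
  have hcode : ∀ v w, code v = code w → 𝒜.ClockEquiv v w := by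
    intro v w hvw
    simp only [code, Prod.mk.injEq] at hvw
    obtain ⟨h1, h2, h3⟩ := hvw
    have hfl : ∀ x, v x ≤ 𝒜.maxConst x → w x ≤ 𝒜.maxConst x ∧ ⌊v x⌋₊ = ⌊w x⌋₊ := by
      intro x hv
      have := congrArg Fin.val (congrFun h1 x)
      have hb := Nat.floor_le_of_le hv
      by_cases hw : w x ≤ 𝒜.maxConst x
      · simp only [hv, hw, dite_true] at this
        exact ⟨hw, this⟩
      · simp only [hv, hw, dite_true, dite_false, Fin.val_last] at this
        omega
    have hfl' : ∀ x, w x ≤ 𝒜.maxConst x → v x ≤ 𝒜.maxConst x := by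
      intro x hw
      have := congrArg Fin.val (congrFun h1 x)
      have hb := Nat.floor_le_of_le hw
      by_contra hv
      simp only [hv, hw, dite_true, dite_false, Fin.val_last] at this
      omega
    refine ⟨fun x => ?_, fun x hx => (hfl x hx).2, fun x y _ _ => ⟨?_, ?_⟩⟩
    · rw [← not_le, ← not_le, not_iff_not]
      exact ⟨fun hx => (hfl x hx).1, hfl' x⟩
    · exact iff_of_eq (congrFun h2 x)
    · exact iff_of_eq (congrFun (congrFun h3 x) y)
  refine Finite.of_injective (fun r : 𝒜.Reg => code (Quotient.out r)) fun r r' hr => ?_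
  exact Quotient.out_equiv_out.1 (hcode _ _ hr)

end Bisimulation

variable {L C A : Type*}

/-! ### Runs -/

/-- The first `n` steps of the sequence of states `f` are transitions. -/
def IsRun (𝒜 : TimedAutomaton L C A) (f : ℕ → TimedState L C) (n : ℕ) : Prop :=
  ∀ j < n, 𝒜.Step (f j) (f (j + 1))

/-- The sequence that follows `f` up to index `n` and continues with `g` from there. -/
def glue (f : ℕ → TimedState L C) (n : ℕ) (g : ℕ → TimedState L C) : ℕ → TimedState L C :=
  fun j => if j ≤ n then f j else g (j - n)

theorem glue_of_le (f g : ℕ → TimedState L C) {n j : ℕ} (h : j ≤ n) : glue f n g j = f j :=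
  if_pos h

theorem glue_add {f g : ℕ → TimedState L C} {n : ℕ} (h : f n = g 0) (j : ℕ) :
    glue f n g (n + j) = g j := by
  rcases j.eq_zero_or_pos with rfl | hj
  · rw [add_zero, glue_of_le f g le_rfl, h]
  · rw [glue, if_neg (by omega), Nat.add_sub_cancel_left]

theorem IsRun.glue {𝒜 : TimedAutomaton L C A} {f g : ℕ → TimedState L C} {n k : ℕ}
    (hf : 𝒜.IsRun f n) (hg : 𝒜.IsRun g k) (h : f n = g 0) : 𝒜.IsRun (glue f n g) (n + k) := by
  intro j hj
  rcases lt_or_ge j n with hjn | hjn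
  · rw [glue_of_le f g hjn.le, glue_of_le f g hjn]
    exact hf j hjn
  · obtain ⟨i, rfl⟩ := Nat.exists_eq_add_of_le hjn
    rw [add_assoc, glue_add h, glue_add h]
    exact hg i (by omega)

theorem IsRun.mono {𝒜 : TimedAutomaton L C A} {f : ℕ → TimedState L C} {n k : ℕ}
    (hf : 𝒜.IsRun f n) (h : k ≤ n) : 𝒜.IsRun f k :=
  fun j hj => hf j (hj.trans_le h)

theorem IsRun.shift {𝒜 : TimedAutomaton L C A} {f : ℕ → TimedState L C} {n k : ℕ}
    (hf : 𝒜.IsRun f (n + k)) : 𝒜.IsRun (fun j => f (n + j)) k :=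
  fun j hj => hf (n + j) (by omega)

theorem IsRun.exists_finPath {𝒜 : TimedAutomaton L C A} {f : ℕ → TimedState L C} {n : ℕ}
    (hf : 𝒜.IsRun f n) :
    ∃ h : 𝒜.FinPath, h.length = n ∧ ∀ i : Fin (h.length + 1), h.state i = f i := by
  choose m hm using hf
  exact ⟨⟨n, fun i => f i, fun j => m j j.2, fun j => hm j j.2⟩, rfl, fun _ => rfl⟩

/-- The sequence of states of a finite path, its last state being repeated forever. -/
def FinPath.seq {𝒜 : TimedAutomaton L C A} (h : 𝒜.FinPath) : ℕ → TimedState L C :=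
  fun j => h.state ⟨min j h.length, by omega⟩

theorem FinPath.seq_val {𝒜 : TimedAutomaton L C A} (h : 𝒜.FinPath) (i : Fin (h.length + 1)) :
    h.seq i = h.state i :=
  congrArg h.state (Fin.ext (min_eq_left (Nat.lt_succ_iff.1 i.2)))

theorem FinPath.seq_length {𝒜 : TimedAutomaton L C A} (h : 𝒜.FinPath) :
    h.seq h.length = h.state (Fin.last h.length) :=
  h.seq_val (Fin.last _)

theorem FinPath.isRun_seq {𝒜 : TimedAutomaton L C A} (h : 𝒜.FinPath) :
    𝒜.IsRun h.seq h.length := by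
  intro j hj
  have h1 := h.seq_val (Fin.castSucc ⟨j, hj⟩)
  have h2 := h.seq_val (Fin.succ ⟨j, hj⟩)
  simp only [Fin.val_castSucc, Fin.val_succ] at h1 h2
  rw [h1, h2]
  exact ⟨_, h.step ⟨j, hj⟩⟩

theorem setReachableFrom_iff {𝒜 : TimedAutomaton L C A} {T : Set (TimedState L C)}
    {s : TimedState L C} :
    𝒜.SetReachableFrom T s ↔ ∃ f n, f 0 = s ∧ 𝒜.IsRun f n ∧ f n ∈ T := by
  constructor
  · rintro ⟨h, h0, hT⟩
    exact ⟨h.seq, h.length, (h.seq_val 0).trans h0, h.isRun_seq, by rwa [h.seq_length]⟩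
  · rintro ⟨f, n, h0, hf, hT⟩
    obtain ⟨h, rfl, hs⟩ := hf.exists_finPath
    exact ⟨h, (hs 0).trans h0, by rwa [hs]⟩

theorem SetReachableFrom.trans {𝒜 : TimedAutomaton L C A} {T : Set (TimedState L C)}
    {s t : TimedState L C} (h₁ : 𝒜.SetReachableFrom {t} s) (h₂ : 𝒜.SetReachableFrom T t) :
    𝒜.SetReachableFrom T s := by
  rw [setReachableFrom_iff] at h₁ h₂ ⊢
  obtain ⟨f, n, hf0, hf, rfl⟩ := h₁
  obtain ⟨g, k, hg0, hg, hT⟩ := h₂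
  refine ⟨glue f n g, n + k, ?_, hf.glue hg hg0.symm, ?_⟩
  · rw [glue_of_le f g n.zero_le, hf0]
  · rwa [glue_add hg0.symm]

theorem IsRun.setReachableFrom {𝒜 : TimedAutomaton L C A} {f : ℕ → TimedState L C} {n i j : ℕ}
    (hf : 𝒜.IsRun f n) (hij : i ≤ j) (hj : j ≤ n) : 𝒜.SetReachableFrom {f j} (f i) := by
  obtain ⟨k, rfl⟩ := Nat.exists_eq_add_of_le hij
  exact setReachableFrom_iff.2 ⟨fun a => f (i + a), k, rfl, (hf.mono hj).shift, rfl⟩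

/-- The special clock advances by exactly the delay of the move. -/
theorem Transition.γ_eq {𝒜 : TimedAutomaton L C A} {s s' : TimedState L C} {δ : ℝ≥0}
    {a : Option A} (h : 𝒜.Transition s (δ, a) s') : s'.2 𝒜.γ = s.2 𝒜.γ + δ := by
  cases a with
  | none =>
    rw [h.1]
    rfl
  | some a =>
    obtain ⟨e, he, -, -, -, -, hr, -⟩ := h
    rw [hr, reset, if_neg (𝒜.γ_notMem_resets e he), delayed]

theorem Step.γ_le {𝒜 : TimedAutomaton L C A} {s s' : TimedState L C} (h : 𝒜.Step s s') :
    s.2 𝒜.γ ≤ s'.2 𝒜.γ := by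
  obtain ⟨⟨δ, a⟩, h⟩ := h
  rw [h.γ_eq]
  exact le_self_add

theorem Step.inv_sat {𝒜 : TimedAutomaton L C A} {s s' : TimedState L C} (h : 𝒜.Step s s') :
    (𝒜.inv s'.1).Sat s'.2 := by
  obtain ⟨⟨δ, _ | a⟩, h⟩ := h
  · obtain ⟨rfl, h⟩ := h
    exact h
  · obtain ⟨e, -, -, -, -, -, -, -, h⟩ := h
    exact h

theorem IsRun.γ_le {𝒜 : TimedAutomaton L C A} {f : ℕ → TimedState L C} {n i j : ℕ}
    (hf : 𝒜.IsRun f n) (hij : i ≤ j) (hj : j ≤ n) : (f i).2 𝒜.γ ≤ (f j).2 𝒜.γ := by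
  induction j, hij using Nat.le_induction with
  | base => exact le_rfl
  | succ j hij ih => exact (ih (by omega)).trans (hf j (by omega)).γ_le

theorem monotone_γ {𝒜 : TimedAutomaton L C A} {f : ℕ → TimedState L C}
    (hf : ∀ j, 𝒜.Step (f j) (f (j + 1))) : Monotone fun j => (f j).2 𝒜.γ :=
  monotone_nat_of_le_succ fun j => (hf j).γ_le

theorem StateEquiv.exists_run [Fintype L] [Finite C] {𝒜 : TimedAutomaton L C A}
    {f : ℕ → TimedState L C} {n : ℕ} {u : TimedState L C} (hf : 𝒜.IsRun f n)
    (h : 𝒜.StateEquiv (f 0) u) :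
    ∃ g, g 0 = u ∧ 𝒜.IsRun g n ∧ ∀ j ≤ n, 𝒜.StateEquiv (f j) (g j) := by
  induction n with
  | zero =>
    refine ⟨fun _ => u, rfl, fun j hj => absurd hj j.not_lt_zero, fun j hj => ?_⟩
    rwa [Nat.le_zero.1 hj]
  | succ n ih =>
    obtain ⟨g, hg0, hg, hfg⟩ := ih (hf.mono n.le_succ)
    obtain ⟨t, ht, hft⟩ := (hfg n le_rfl).exists_step (hf n n.lt_succ_self)
    refine ⟨Function.update g (n + 1) t, ?_, fun j hj => ?_, fun j hj => ?_⟩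
    · rw [Function.update_of_ne (by omega), hg0]
    · rw [Function.update_of_ne (by omega : j ≠ n + 1)]
      rcases (Nat.lt_succ_iff.1 hj).eq_or_lt with rfl | hlt
      · rwa [Function.update_self]
      · rw [Function.update_of_ne (by omega)]
        exact hg j hlt
    · rcases hj.eq_or_lt with rfl | hlt
      · rwa [Function.update_self]
      · rw [Function.update_of_ne (by omega)]
        exact hfg j (by omega)

/-! ### Smallest priorities -/

theorem odd_minPriority_iff (p : L → ℕ) {ι : Type*} [LinearOrder ι] [LocallyFiniteOrderBot ι]
    (s : ι → TimedState L C) (i : ι) :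
    Odd (minPriority p s i) ↔
      ∃ j ≤ i, Odd (p (s j).1) ∧ ∀ k ≤ i, p (s j).1 ≤ p (s k).1 := by
  constructor
  · intro h
    obtain ⟨j, hj, hmin⟩ := Finset.exists_mem_eq_inf' (Finset.nonempty_Iic (a := i))
      fun j => p (s j).1
    have hmin' : minPriority p s i = p (s j).1 := hmin
    refine ⟨j, Finset.mem_Iic.1 hj, hmin' ▸ h, fun k hk => hmin' ▸ ?_⟩
    exact Finset.inf'_le _ (Finset.mem_Iic.2 hk)
  · rintro ⟨j, hj, hodd, hmin⟩
    have : minPriority p s i = p (s j).1 :=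
      le_antisymm (Finset.inf'_le _ (Finset.mem_Iic.2 hj))
        (Finset.le_inf' _ _ fun k hk => hmin k (Finset.mem_Iic.1 hk))
    rwa [this]

theorem odd_minPriority_congr (p : L → ℕ) {f g : ℕ → TimedState L C} {n : ℕ}
    (h : ∀ j ≤ n, (f j).1 = (g j).1) : Odd (minPriority p f n) ↔ Odd (minPriority p g n) := by
  rw [show minPriority p f n = minPriority p g n from
    Finset.inf'_congr _ rfl fun j hj => congrArg p (h j (Finset.mem_Iic.1 hj))]

theorem odd_minPriority_fin_iff (p : L → ℕ) {n : ℕ} {s : Fin (n + 1) → TimedState L C}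
    {f : ℕ → TimedState L C} (h : ∀ i : Fin (n + 1), f i = s i) (i : Fin (n + 1)) :
    Odd (minPriority p s i) ↔ Odd (minPriority p f i) := by
  rw [odd_minPriority_iff, odd_minPriority_iff]
  constructor
  · rintro ⟨j, hj, hodd, hmin⟩
    refine ⟨j, hj, by rwa [h], fun k hk => ?_⟩
    have := hmin ⟨k, by omega⟩ hk
    rwa [h j, h ⟨k, by omega⟩]
  · rintro ⟨j, hj, hodd, hmin⟩
    have hj' := h ⟨j, by omega⟩
    refine ⟨⟨j, by omega⟩, hj, by rwa [← hj'], fun k hk => ?_⟩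
    rw [← hj', ← h]
    exact hmin k hk

theorem notMem_TGW_iff {𝒜 : TimedAutomaton L C A} {p : L → ℕ} {lam : ℕ}
    {s : ℕ → TimedState L C} :
    s ∉ 𝒜.TGW p lam ↔
      ∀ n, (s n).2 𝒜.γ < (s 0).2 𝒜.γ + (lam : ℝ≥0) → Odd (minPriority p s n) := by
  simp only [TGW, Set.mem_ofPred_eq, not_exists, not_and, ← Nat.not_even_iff_odd, Nat.even_iff]
  refine forall_congr' fun n => ?_
  rw [← NNReal.coe_lt_coe, NNReal.coe_add, NNReal.coe_natCast, sub_lt_iff_lt_add']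
  exact ⟨fun h h1 h2 => h h2 h1, fun h h1 h2 => h h2 h1⟩

theorem notMem_FTW_iff {𝒜 : TimedAutomaton L C A} {p : L → ℕ} {lam : ℕ}
    {s : ℕ → TimedState L C} :
    s ∉ 𝒜.FTW p lam ↔ ∀ n, ∃ m ≥ n, (fun k => s (m + k)) ∉ 𝒜.TGW p lam := by
  simp only [FTW, DFTW, Set.mem_ofPred_eq, not_exists, not_forall]
  refine forall_congr' fun n => ⟨?_, ?_⟩
  · rintro ⟨m, hm⟩
    exact ⟨n + m, Nat.le_add_right n m, by simpa only [add_assoc] using hm⟩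
  · rintro ⟨m, hm, h⟩
    obtain ⟨k, rfl⟩ := Nat.exists_eq_add_of_le hm
    exact ⟨k, by simpa only [add_assoc] using h⟩

/-! ### Splitting delays -/

/-- Clock constraints are convex. -/
theorem _root_.ClockConstraint.Sat.of_between {v u w : C → ℝ≥0} {g : ClockConstraint C}
    (hv : g.Sat v) (hw : g.Sat w) (h₁ : v ≤ u) (h₂ : u ≤ w) : g.Sat u := by
  induction g with
  | tt => trivial
  | conj g₁ g₂ ih₁ ih₂ => exact ⟨ih₁ hv.1 hw.1, ih₂ hv.2 hw.2⟩
  | atom x r c =>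
    cases r
    · exact (h₂ x).trans hw
    · exact le_trans (show (c : ℝ≥0) ≤ v x from hv) (h₁ x)
    · exact lt_of_lt_of_le (show (c : ℝ≥0) < v x from hv) (h₁ x)
    · exact (h₂ x).trans_lt hw

theorem delayed_delayed (v : C → ℝ≥0) (δ δ' : ℝ≥0) :
    delayed (delayed v δ) δ' = delayed v (δ + δ') :=
  funext fun _ => add_assoc _ _ _

/-- Between two consecutive states, the special clock can be stopped at any intermediate value,
in the location of the first state. This needs the first state to satisfy its invariant, which may
fail for the initial state. -/
theorem Step.exists_split {𝒜 : TimedAutomaton L C A} {s s' : TimedState L C} (h : 𝒜.Step s s')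
    (hs : (𝒜.inv s.1).Sat s.2) {T : ℝ≥0} (h₁ : s.2 𝒜.γ ≤ T) (h₂ : T ≤ s'.2 𝒜.γ) :
    ∃ q : TimedState L C, q.1 = s.1 ∧ q.2 𝒜.γ = T ∧ 𝒜.Step s q ∧ 𝒜.Step q s' := by
  obtain ⟨⟨δ, a⟩, h⟩ := h
  obtain ⟨δ₁, rfl⟩ := exists_add_of_le h₁
  rw [h.γ_eq, add_le_add_iff_left] at h₂
  obtain ⟨δ₂, rfl⟩ := exists_add_of_le h₂
  have hinv : (𝒜.inv s.1).Sat (delayed s.2 (δ₁ + δ₂)) := by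
    cases a with
    | none => exact h.2
    | some a =>
      obtain ⟨e, -, -, -, -, -, -, h, -⟩ := h
      exact h
  have hq : (𝒜.inv s.1).Sat (delayed s.2 δ₁) :=
    hs.of_between hinv (fun _ => le_self_add) fun x => by
      change s.2 x + δ₁ ≤ s.2 x + (δ₁ + δ₂)
      exact add_le_add_right h₂ _
  refine ⟨(s.1, delayed s.2 δ₁), rfl, rfl, ⟨(δ₁, none), rfl, hq⟩, ⟨(δ₂, a), ?_⟩⟩
  cases a with
  | none =>
    obtain ⟨rfl, -⟩ := h
    exact ⟨by rw [delayed_delayed], by rwa [delayed_delayed]⟩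
  | some a =>
    simpa only [Transition, delayed_delayed] using h

/-! ### Pumping a loop in which time passes -/

theorem IsIntegerValue.eq_floor {t : ℝ≥0} (h : IsIntegerValue t) : t = (⌊t⌋₊ : ℝ≥0) := by
  obtain ⟨k, rfl⟩ := h
  simp

/-- If `x` and `y` agree on being an integer while `a` and `b`, lying between them, do not, then an
integer lies in `(x, y]`. -/
theorem floor_lt_floor_of_xor {x a b y : ℝ≥0} (hxa : x ≤ a) (hay : a ≤ y) (hxb : x ≤ b)
    (hby : b ≤ y) (hxy : IsIntegerValue x ↔ IsIntegerValue y)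
    (hab : Xor (IsIntegerValue a) (IsIntegerValue b)) : ⌊x⌋₊ < ⌊y⌋₊ := by
  by_contra hlt
  have hfl : ∀ z, x ≤ z → z ≤ y → IsIntegerValue z → x = y := by
    intro z hxz hzy hz
    have hx : z ≤ x := by
      rw [hz.eq_floor]
      refine le_trans ?_ (Nat.floor_le (zero_le (a := x)))
      exact_mod_cast (Nat.floor_mono hzy).trans (not_lt.1 hlt)
    have hzx : x = z := le_antisymm hxz hx
    have hxi : IsIntegerValue x := hzx ▸ hz
    have hyi := hxy.1 hxi
    refine le_antisymm (hxz.trans hzy) ?_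
    rw [hyi.eq_floor, hxi.eq_floor]
    exact_mod_cast not_lt.1 hlt
  rcases hab with ⟨h1, h2⟩ | ⟨h1, h2⟩
  · have := hfl a hxa hay h1
    subst this
    exact h2 (le_antisymm (hby.trans hxa) (hay.trans hxb) ▸ h1)
  · have := hfl b hxb hby h1
    subst this
    exact h2 (le_antisymm (hby.trans hxa) (hay.trans hxb) ▸ h1)

/-- A run with odd prefixes that ends in a loop (up to equivalence) along which the special clock
changes between integer and non-integer values can be imitated from every state equivalent to its
first one, with the loop taken `r` times. Each turn takes the special clock past an integer, and
introduces no new location, so that all prefixes remain odd. -/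
theorem exists_run_of_loop [Fintype L] [Finite C] {𝒜 : TimedAutomaton L C A} {p : L → ℕ}
    {F : ℕ → TimedState L C} {K i₂ i₃ i₄ : ℕ} (hF : 𝒜.IsRun F K) (h₂₃ : i₂ ≤ i₃) (h₃₄ : i₃ ≤ i₄)
    (h₄ : i₄ ≤ K) (hloop : 𝒜.StateEquiv (F i₂) (F K))
    (hxor : Xor (IsIntegerValue ((F i₃).2 𝒜.γ)) (IsIntegerValue ((F i₄).2 𝒜.γ)))
    (hodd : ∀ i ≤ K, Odd (minPriority p F i)) (r : ℕ) {u : TimedState L C}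
    (hu : 𝒜.StateEquiv (F 0) u) :
    ∃ g n, g 0 = u ∧ 𝒜.IsRun g n ∧ 𝒜.StateEquiv (F K) (g n) ∧
      ⌊(g 0).2 𝒜.γ⌋₊ + r ≤ ⌊(g n).2 𝒜.γ⌋₊ ∧ ∀ i ≤ n, Odd (minPriority p g i) := by
  obtain ⟨m, hmK, hm, hmin⟩ := (odd_minPriority_iff p F K).1 (hodd K le_rfl)
  suffices ∃ g n, g 0 = u ∧ 𝒜.IsRun g n ∧ 𝒜.StateEquiv (F K) (g n) ∧
      ⌊(g 0).2 𝒜.γ⌋₊ + r ≤ ⌊(g n).2 𝒜.γ⌋₊ ∧ (∀ i ≤ n, Odd (minPriority p g i)) ∧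
      ∃ j ≤ n, (g j).1 = (F m).1 ∧ ∀ k ≤ n, p (F m).1 ≤ p (g k).1 by
    obtain ⟨g, n, h1, h2, h3, h4, h5, -⟩ := this
    exact ⟨g, n, h1, h2, h3, h4, h5⟩
  induction r with
  | zero =>
    obtain ⟨g, hg0, hg, hFg⟩ := hu.exists_run hF
    refine ⟨g, K, hg0, hg, hFg K le_rfl, Nat.floor_mono (hg.γ_le K.zero_le le_rfl),
      fun i hi => ?_, m, hmK, (hFg m hmK).1.symm, fun k hk => ?_⟩
    · exact (odd_minPriority_congr p fun j hj => (hFg j (hj.trans hi)).1).1 (hodd i hi)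
    · rw [← (hFg k hk).1]
      exact hmin k hk
  | succ r ih =>
    obtain ⟨g, n, hg0, hg, hgn, hfl, hgodd, j, hj, hgj, hgmin⟩ := ih
    obtain ⟨l, rfl⟩ := Nat.exists_eq_add_of_le (h₂₃.trans (h₃₄.trans h₄))
    obtain ⟨g', hg'0, hg', hFg'⟩ := (hloop.trans hgn).exists_run (f := fun j => F (i₂ + j))
      (n := l) hF.shift
    have hlt : ⌊(g n).2 𝒜.γ⌋₊ < ⌊(g' l).2 𝒜.γ⌋₊ := by
      obtain ⟨a, rfl⟩ := Nat.exists_eq_add_of_le h₂₃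
      obtain ⟨b, rfl⟩ := Nat.exists_eq_add_of_le (h₂₃.trans h₃₄)
      have ha := (hFg' a (by omega)).2.isIntegerValue_γ_iff
      have hb := (hFg' b (by omega)).2.isIntegerValue_γ_iff
      rw [← hg'0]
      refine floor_lt_floor_of_xor (hg'.γ_le a.zero_le (by omega)) (hg'.γ_le (by omega) le_rfl)
        (hg'.γ_le b.zero_le (by omega)) (hg'.γ_le (by omega) le_rfl) ?_ (by rwa [← ha, ← hb])
      exact (((hFg' 0 l.zero_le).symm.trans hloop).trans
        (hFg' l le_rfl)).2.isIntegerValue_γ_iff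
    have hleft : ∀ k ≤ n, glue g n g' k = g k := fun k hk => glue_of_le g g' hk
    have hright : ∀ k, glue g n g' (n + k) = g' k := glue_add hg'0.symm
    have hmin' : ∀ k ≤ n + l, p (F m).1 ≤ p (glue g n g' k).1 := by
      intro k hk
      rcases le_total k n with hkn | hkn
      · rw [hleft k hkn]
        exact hgmin k hkn
      · obtain ⟨k, rfl⟩ := Nat.exists_eq_add_of_le hkn
        rw [hright, ← (hFg' k (by omega)).1]
        exact hmin _ (by omega)
    refine ⟨glue g n g', n + l, ?_, hg.glue hg' hg'0.symm, ?_, ?_, fun i hi => ?_, j, by omega, ?_,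
      hmin'⟩
    · rw [hleft 0 n.zero_le, hg0]
    · rw [hright]
      exact hFg' l le_rfl
    · rw [hright, hleft 0 n.zero_le]
      omega
    · rcases le_total i n with hin | hin
      · exact (odd_minPriority_congr p fun k hk => by rw [hleft k (hk.trans hin)]).2 (hgodd i hin)
      · refine (odd_minPriority_iff p _ i).2 ⟨j, hj.trans hin, ?_, fun k hk => ?_⟩
        · rwa [hleft j hj, hgj]
        · rw [hleft j hj, hgj]
          exact hmin' k (hk.trans hi)
    · rw [hleft j hj, hgj]

/-! ### Infinite concatenation of runs -/

/-- Runs can be chained forever if each one ends in a state from which the next one can start. The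
`r`-th of them occupies the indices from `off r` on. -/
theorem exists_concat {𝒜 : TimedAutomaton L C A} {P : TimedState L C → Prop}
    {Q : ℕ → (ℕ → TimedState L C) → ℕ → Prop} {u₀ : TimedState L C} (hu₀ : P u₀)
    (hQ : ∀ r u, P u → ∃ g n, 0 < n ∧ g 0 = u ∧ 𝒜.IsRun g n ∧ P (g n) ∧ Q r g n) :
    ∃ f : ℕ → TimedState L C, f 0 = u₀ ∧ (∀ j, 𝒜.Step (f j) (f (j + 1))) ∧ ∃ off : ℕ → ℕ, StrictMono off ∧
      ∀ r, ∃ g n, Q r g n ∧ ∀ j ≤ n, f (off r + j) = g j := by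
  choose G N hpos h0 hrun hP hQ using hQ
  let u : ℕ → {u // P u} := fun r =>
    r.rec ⟨u₀, hu₀⟩ fun r u => ⟨G r u.1 u.2 (N r u.1 u.2), hP r u.1 u.2⟩
  let b : ℕ → ℕ → TimedState L C := fun r => G r (u r).1 (u r).2
  let len : ℕ → ℕ := fun r => N r (u r).1 (u r).2
  have hb : ∀ r, b r (len r) = b (r + 1) 0 := fun r => (h0 (r + 1) _ (u (r + 1)).2).symm
  have hlen : ∀ r, 0 < len r := fun r => hpos r _ (u r).2
  -- `cfg j` consists of the number of the run containing the index `j` and the position in it.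
  let next : ℕ × ℕ → ℕ × ℕ := fun c => if c.2 + 1 < len c.1 then (c.1, c.2 + 1) else (c.1 + 1, 0)
  let cfg : ℕ → ℕ × ℕ := fun j => next^[j] (0, 0)
  have hcfg : ∀ j, cfg (j + 1) = next (cfg j) := fun j => Function.iterate_succ_apply' next j _
  have hcfg_lt : ∀ j, (cfg j).2 < len (cfg j).1 := by
    intro j
    induction j with
    | zero => exact hlen 0
    | succ j ih =>
      rw [hcfg]
      by_cases h : (cfg j).2 + 1 < len (cfg j).1
      · simp [next, h]
      · simpa [next, h] using hlen _
  have hval : ∀ c : ℕ × ℕ, c.2 < len c.1 → b (next c).1 (next c).2 = b c.1 (c.2 + 1) := by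
    intro c hc
    by_cases h : c.2 + 1 < len c.1
    · simp [next, h]
    · have : c.2 + 1 = len c.1 := by omega
      simp only [next, this, lt_self_iff_false, if_false]
      exact (hb c.1).symm
  let off : ℕ → ℕ := fun r => ∑ i ∈ Finset.range r, len i
  have hoff : ∀ r, off (r + 1) = off r + len r := fun r => Finset.sum_range_succ _ _
  have hblock : ∀ r, cfg (off r) = (r, 0) → ∀ i < len r, cfg (off r + i) = (r, i) := by
    intro r hr i
    induction i with
    | zero => exact fun _ => hr
    | succ i ih =>
      intro hi
      rw [← add_assoc, hcfg, ih (by omega)]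
      simp [next, hi]
  have hstart : ∀ r, cfg (off r) = (r, 0) := by
    intro r
    induction r with
    | zero => rfl
    | succ r ih =>
      obtain ⟨l, hl⟩ := Nat.exists_eq_add_of_lt (hlen r)
      rw [zero_add] at hl
      rw [hoff, hl, ← add_assoc, hcfg, hblock r ih l (by omega)]
      simp [next, hl]
  refine ⟨fun j => b (cfg j).1 (cfg j).2, h0 0 _ _, fun j => ?_, off,
    strictMono_nat_of_lt_succ fun r => ?_, fun r => ⟨b r, len r, hQ r _ _, fun j hj => ?_⟩⟩
  · change 𝒜.Step (b (cfg j).1 (cfg j).2) (b (cfg (j + 1)).1 (cfg (j + 1)).2)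
    rw [hcfg, hval _ (hcfg_lt j)]
    exact hrun _ _ _ _ (hcfg_lt j)
  · have := hlen r
    rw [hoff]
    omega
  · change b (cfg (off r + j)).1 (cfg (off r + j)).2 = b r j
    rcases hj.eq_or_lt with rfl | hlt
    · rw [← hoff, hstart]
      exact (hb r).symm
    · rw [hblock r (hstart r) j hlt]

theorem exists_infPath {𝒜 : TimedAutomaton L C A} {f : ℕ → TimedState L C}
    (hf : ∀ j, 𝒜.Step (f j) (f (j + 1))) : ∃ π : 𝒜.InfPath, π.state = f := by
  choose m hm using hf
  exact ⟨⟨f, m, hm⟩, rfl⟩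

theorem SetReachableFrom.of_stateEquiv [Fintype L] [Finite C] {𝒜 : TimedAutomaton L C A}
    {s t u : TimedState L C} (h : 𝒜.SetReachableFrom (𝒜.stateRegion u) s)
    (hst : 𝒜.StateEquiv s t) : 𝒜.SetReachableFrom (𝒜.stateRegion u) t := by
  obtain ⟨f, n, rfl, hf, hn⟩ := setReachableFrom_iff.1 h
  obtain ⟨g, hg0, hg, hfg⟩ := hst.exists_run hf
  exact setReachableFrom_iff.2 ⟨g, n, hg0, hg, (hfg n le_rfl).symm.trans hn⟩

/-- A run with odd prefixes that ends in a time-consuming loop and can be repeated gives a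
time-divergent path outside of the bounded objective: the `r`-th repetition takes the loop more
than `r` times. -/
theorem exists_timeDivergent_notMem_BTW [Fintype L] [Finite C] {𝒜 : TimedAutomaton L C A}
    {p : L → ℕ} {F : ℕ → TimedState L C} {K i₂ i₃ i₄ : ℕ} (hreach : 𝒜.Reachable (F 0))
    (hF : 𝒜.IsRun F K) (h₂₃ : i₂ ≤ i₃) (h₃₄ : i₃ ≤ i₄) (h₄ : i₄ ≤ K)
    (hloop : 𝒜.StateEquiv (F i₂) (F K))
    (hxor : Xor (IsIntegerValue ((F i₃).2 𝒜.γ)) (IsIntegerValue ((F i₄).2 𝒜.γ)))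
    (hodd : ∀ i ≤ K, Odd (minPriority p F i))
    (hret : 𝒜.SetReachableFrom (𝒜.stateRegion (F 0)) (F K)) :
    ∃ π : 𝒜.InfPath, π.IsInitial ∧ π.TimeDivergent ∧ π.state ∉ 𝒜.BTW p := by
  obtain ⟨f, hf0, hf, off, hoff, hblock⟩ := exists_concat (𝒜 := 𝒜)
    (P := 𝒜.SetReachableFrom (𝒜.stateRegion (F 0)))
    (Q := fun r g n => ∃ a ≤ n, (g a).2 𝒜.γ + (r : ℝ≥0) ≤ (g n).2 𝒜.γ ∧
      ∀ i, a + i ≤ n → Odd (minPriority p (fun k => g (a + k)) i))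
    (u₀ := 𝒜.initState)
    (hreach.trans (setReachableFrom_iff.2
      ⟨fun _ => F 0, 0, rfl, fun j hj => absurd hj j.not_lt_zero, StateEquiv.refl 𝒜 _⟩)) (by
    intro r u hu
    obtain ⟨g, a, hg0, hg, hga⟩ := setReachableFrom_iff.1 hu
    obtain ⟨g', n, hg'0, hg', hKn, hfl, hg'odd⟩ := exists_run_of_loop hF h₂₃ h₃₄ h₄ hloop hxor
      hodd (r + 1) (StateEquiv.symm hga)
    have hright : ∀ k, glue g a g' (a + k) = g' k := glue_add hg'0.symm
    refine ⟨glue g a g', a + n, ?_, ?_, hg.glue hg' hg'0.symm, ?_, a, by omega, ?_, ?_⟩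
    · rcases n.eq_zero_or_pos with rfl | hn
      · omega
      · omega
    · rw [glue_of_le g g' a.zero_le, hg0]
    · rw [hright]
      exact hret.of_stateEquiv hKn
    · rw [hright, glue_of_le g g' le_rfl, ← hg'0]
      have h1 : (g' 0).2 𝒜.γ < (⌊(g' 0).2 𝒜.γ⌋₊ : ℝ≥0) + 1 := Nat.lt_floor_add_one _
      have h2 : (⌊(g' n).2 𝒜.γ⌋₊ : ℝ≥0) ≤ (g' n).2 𝒜.γ := Nat.floor_le zero_le
      have h3 : (⌊(g' 0).2 𝒜.γ⌋₊ : ℝ≥0) + (r + 1) ≤ ⌊(g' n).2 𝒜.γ⌋₊ := by exact_mod_cast hfl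
      calc (g' 0).2 𝒜.γ + (r : ℝ≥0) ≤ (⌊(g' 0).2 𝒜.γ⌋₊ : ℝ≥0) + 1 + r := by gcongr
        _ = (⌊(g' 0).2 𝒜.γ⌋₊ : ℝ≥0) + (r + 1) := by ring
        _ ≤ _ := h3.trans h2
    · intro i hi
      simp only [hright]
      exact hg'odd i (by omega))
  obtain ⟨π, rfl⟩ := exists_infPath hf
  have hmono := monotone_γ hf
  refine ⟨π, hf0, ?_, ?_⟩
  · rintro ⟨B, hB⟩
    obtain ⟨r, hr⟩ := exists_nat_gt B
    obtain ⟨g, n, ⟨a, han, hγ, -⟩, hg⟩ := hblock r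
    have h1 : (π.state (off r + n)).2 𝒜.γ ≤ B := hB ⟨_, rfl⟩
    rw [hg n le_rfl] at h1
    exact absurd (le_add_self.trans (hγ.trans h1)) hr.not_ge
  · rintro ⟨lam, h⟩
    refine notMem_FTW_iff.2 (fun N => ?_) h
    -- The repetition with this number starts after index `N` and lasts for at least `lam`.
    obtain ⟨g, n, ⟨a, han, hγ, hgodd⟩, hg⟩ := hblock (max lam N)
    refine ⟨off (max lam N) + a, ?_, notMem_TGW_iff.2 fun k hk => ?_⟩
    · have := hoff.le_apply (x := max lam N)
      omega
    have hkn : a + k ≤ n := by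
      by_contra hlt
      have h1 : (g n).2 𝒜.γ ≤ (π.state (off (max lam N) + a + k)).2 𝒜.γ := by
        rw [← hg n le_rfl]
        exact hmono (by omega)
      rw [add_zero, hg a han] at hk
      have h2 : (lam : ℝ≥0) ≤ (max lam N : ℕ) := by exact_mod_cast le_max_left _ _
      exact absurd ((add_le_add_right h2 _).trans (hγ.trans h1)) hk.not_ge
    refine (odd_minPriority_congr p fun j hj => ?_).2 (hgodd k hkn)
    simp only [add_assoc, hg (a + j) (by omega)]

/-! ### Extracting a loop from a long bad window -/

/-- An infinite sequence of transitions, through states that satisfy their invariants, along which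
time diverges and which visits the region of its first state infinitely often, although no good
window of length less than `lam` starts at index `0`. -/
structure IsRecurrentBad [Fintype L] (𝒜 : TimedAutomaton L C A) (p : L → ℕ) (lam : ℕ)
    (f : ℕ → TimedState L C) : Prop where
  step : ∀ j, 𝒜.Step (f j) (f (j + 1))
  inv_sat : ∀ j, (𝒜.inv (f j).1).Sat (f j).2
  unbounded : ∀ T, ∃ j, T < (f j).2 𝒜.γ
  odd : ∀ i, (f i).2 𝒜.γ < (f 0).2 𝒜.γ + (lam : ℝ≥0) → Odd (minPriority p f i)
  recurrent : ∀ n, ∃ j ≥ n, 𝒜.StateEquiv (f j) (f 0)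

/-- Inserting a state at which the special clock has a prescribed value. The new state repeats the
location preceding it, so the smallest priorities of prefixes do not change. -/
theorem IsRecurrentBad.exists_insert [Fintype L] {𝒜 : TimedAutomaton L C A} {p : L → ℕ} {lam : ℕ}
    {f : ℕ → TimedState L C} (hf : 𝒜.IsRecurrentBad p lam f) {T : ℝ≥0}
    (hT : (f 0).2 𝒜.γ ≤ T) :
    ∃ f', 𝒜.IsRecurrentBad p lam f' ∧ f' 0 = f 0 ∧ (∃ k, (f' k).2 𝒜.γ = T) ∧
      ∀ j, ∃ j', f' j' = f j := by
  classical
  obtain ⟨k, hk₁, hk₂⟩ : ∃ k, (f k).2 𝒜.γ ≤ T ∧ T < (f (k + 1)).2 𝒜.γ := by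
    have hex := hf.unbounded T
    obtain ⟨k, hk⟩ := Nat.exists_eq_succ_of_ne_zero (n := Nat.find hex) fun h0 =>
      (h0 ▸ Nat.find_spec hex).not_ge hT
    exact ⟨k, not_lt.1 (Nat.find_min hex (by omega)), by simpa [hk] using Nat.find_spec hex⟩
  obtain ⟨q, hq₁, hq₂, hq₃, hq₄⟩ := (hf.step k).exists_split (hf.inv_sat k) hk₁ hk₂.le
  let f' : ℕ → TimedState L C := fun j => if j ≤ k then f j else if j = k + 1 then q else f (j - 1)
  have hA : ∀ i ≤ k, f' i = f i := fun i hi => if_pos hi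
  have hB : f' (k + 1) = q := by simp [f']
  have hC : ∀ i, k + 1 ≤ i → f' (i + 1) = f i := fun i hi => by
    simp only [f', if_neg (by omega : ¬ i + 1 ≤ k), if_neg (by omega : i + 1 ≠ k + 1),
      Nat.add_sub_cancel]
  have hloc : ∀ i, k ≤ i → (f' (i + 1)).1 = (f i).1 := by
    intro i hi
    rcases hi.eq_or_lt with rfl | hlt
    · rw [hB, hq₁]
    · rw [hC i hlt]
  have hall : ∀ {R : TimedState L C → Prop}, (∀ i, R (f i)) → R q → ∀ i, R (f' i) := by
    intro R h1 h2 i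
    rcases le_or_gt i k with hi | hi
    · rw [hA i hi]
      exact h1 i
    · obtain ⟨i, rfl⟩ := Nat.exists_eq_succ_of_ne_zero (show i ≠ 0 by omega)
      rcases (Nat.lt_succ_iff.1 hi).eq_or_lt with rfl | hlt
      · rwa [hB]
      · rw [Nat.succ_eq_add_one, hC i hlt]
        exact h1 i
  have hsurj : ∀ j, ∃ j' ≥ j, f' j' = f j := by
    intro j
    rcases le_or_gt j k with hj | hj
    · exact ⟨j, le_rfl, hA j hj⟩
    · exact ⟨j + 1, j.le_succ, hC j hj⟩
  have h0 : f' 0 = f 0 := hA 0 k.zero_le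
  refine ⟨f', ⟨fun j => ?_, hall (R := fun s => (𝒜.inv s.1).Sat s.2) hf.inv_sat hq₃.inv_sat, fun T => ?_, fun i hi => ?_, fun n => ?_⟩,
    h0, ⟨k + 1, by rw [hB, hq₂]⟩, fun j => ?_⟩
  · rcases lt_trichotomy j k with hj | rfl | hj
    · rw [hA j hj.le, hA (j + 1) hj]
      exact hf.step j
    · rwa [hA j le_rfl, hB]
    · obtain ⟨j, rfl⟩ := Nat.exists_eq_succ_of_ne_zero (show j ≠ 0 by omega)
      rw [Nat.succ_eq_add_one, hC (j + 1) (by omega)]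
      rcases (Nat.lt_succ_iff.1 hj).eq_or_lt with rfl | hlt
      · rwa [hB]
      · rw [hC j hlt]
        exact hf.step j
  · obtain ⟨j, hj⟩ := hf.unbounded T
    obtain ⟨j', -, hj'⟩ := hsurj j
    exact ⟨j', hj' ▸ hj⟩
  · rw [h0] at hi
    rcases le_or_gt i k with hik | hik
    · rw [hA i hik] at hi
      exact (odd_minPriority_congr p fun j hj => by rw [hA j (hj.trans hik)]).2 (hf.odd i hi)
    obtain ⟨i, rfl⟩ := Nat.exists_eq_succ_of_ne_zero (show i ≠ 0 by omega)
    have hki := Nat.lt_succ_iff.1 hik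
    have hγ : (f i).2 𝒜.γ ≤ (f' (i + 1)).2 𝒜.γ := by
      rcases hki.eq_or_lt with rfl | hlt
      · rwa [hB, hq₂]
      · rw [hC i hlt]
    obtain ⟨m, hmi, hm, hmin⟩ := (odd_minPriority_iff p f i).1 (hf.odd i (hγ.trans_lt hi))
    obtain ⟨m', hm'i, hm'⟩ : ∃ m' ≤ i + 1, (f' m').1 = (f m).1 := by
      rcases le_or_gt m k with hmk | hmk
      · exact ⟨m, by omega, by rw [hA m hmk]⟩
      · exact ⟨m + 1, by omega, hloc m hmk.le⟩
    refine (odd_minPriority_iff p f' (i + 1)).2 ⟨m', hm'i, by rwa [hm'], fun j hj => ?_⟩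
    rw [hm']
    rcases le_or_gt j k with hjk | hjk
    · rw [hA j hjk]
      exact hmin j (hjk.trans hki)
    · obtain ⟨j, rfl⟩ := Nat.exists_eq_succ_of_ne_zero (show j ≠ 0 by omega)
      rw [Nat.succ_eq_add_one, hloc j (Nat.lt_succ_iff.1 hjk)]
      exact hmin j (by omega)
  · obtain ⟨j, hj, hej⟩ := hf.recurrent n
    obtain ⟨j', hj', he⟩ := hsurj j
    exact ⟨j', hj.trans hj', by rwa [he, h0]⟩
  · obtain ⟨j', -, h⟩ := hsurj j
    exact ⟨j', h⟩

theorem IsRecurrentBad.exists_insert_finset [Fintype L] {𝒜 : TimedAutomaton L C A} {p : L → ℕ}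
    {lam : ℕ} {f : ℕ → TimedState L C} (hf : 𝒜.IsRecurrentBad p lam f) (S : Finset ℝ≥0)
    (hS : ∀ T ∈ S, (f 0).2 𝒜.γ ≤ T) :
    ∃ f', 𝒜.IsRecurrentBad p lam f' ∧ f' 0 = f 0 ∧ ∀ T ∈ S, ∃ k, (f' k).2 𝒜.γ = T := by
  classical
  induction S using Finset.induction_on with
  | empty => exact ⟨f, hf, rfl, by simp⟩
  | insert T S _ ih =>
    obtain ⟨g, hg, hg0, hgS⟩ := ih fun T' hT' => hS T' (Finset.mem_insert_of_mem hT')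
    obtain ⟨g', hg', hg'0, hg'T, hsub⟩ := hg.exists_insert (T := T)
      (hg0 ▸ hS T (Finset.mem_insert_self _ _))
    refine ⟨g', hg', hg'0.trans hg0, fun T' hT' => ?_⟩
    rcases Finset.mem_insert.1 hT' with rfl | hT'
    · exact hg'T
    · obtain ⟨k, hk⟩ := hgS T' hT'
      obtain ⟨k', hk'⟩ := hsub k
      exact ⟨k', by rw [hk', hk]⟩

theorem not_isIntegerValue_add_half (n : ℕ) : ¬ IsIntegerValue ((n : ℝ≥0) + 2⁻¹) := by
  rintro ⟨k, hk⟩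
  have h : (2 : ℝ≥0) * n + 1 = 2 * k := by
    rw [← hk, mul_add, mul_inv_cancel₀ two_ne_zero]
  have h' : 2 * n + 1 = 2 * k := by exact_mod_cast h
  omega

/-- A window of length greater than the number of state regions contains two equivalent states
whose special clocks have distinct integer values, and time passes between them. -/
theorem IsRecurrentBad.exists_loop [Fintype L] [Finite C] {𝒜 : TimedAutomaton L C A} {p : L → ℕ}
    {lam : ℕ} {f : ℕ → TimedState L C} (hf : 𝒜.IsRecurrentBad p lam f)
    (hlam : Fintype.card L * Nat.card 𝒜.Reg < lam) :
    ∃ f', 𝒜.IsRecurrentBad p lam f' ∧ f' 0 = f 0 ∧ ∃ i₂ i₄ K, i₂ ≤ i₄ ∧ i₄ ≤ K ∧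
      𝒜.StateEquiv (f' i₂) (f' K) ∧ IsIntegerValue ((f' i₂).2 𝒜.γ) ∧
      ¬ IsIntegerValue ((f' i₄).2 𝒜.γ) ∧ ∀ i ≤ K, Odd (minPriority p f' i) := by
  classical
  set M := Fintype.card L * Nat.card 𝒜.Reg with hM
  set t := (f 0).2 𝒜.γ with ht
  have hceil : t ≤ (⌈t⌉₊ : ℝ≥0) := Nat.le_ceil t
  have hle : ∀ i : ℕ, t ≤ ((⌈t⌉₊ + i : ℕ) : ℝ≥0) := fun i =>
    hceil.trans (by exact_mod_cast Nat.le_add_right _ _)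
  -- `M + 1` consecutive integers, so that two of them are reached in the same state region, and
  -- the half-integers following them, to witness a non-integer value in between.
  let S : Finset ℝ≥0 := (Finset.range (M + 1)).image (fun i => ((⌈t⌉₊ + i : ℕ) : ℝ≥0)) ∪
    (Finset.range (M + 1)).image (fun i => ((⌈t⌉₊ + i : ℕ) : ℝ≥0) + 2⁻¹)
  obtain ⟨g, hg, hg0, hgS⟩ := hf.exists_insert_finset S (by
    intro T hT
    rcases Finset.mem_union.1 hT with hT | hT
    · obtain ⟨i, -, rfl⟩ := Finset.mem_image.1 hT
      exact hle i
    · obtain ⟨i, -, rfl⟩ := Finset.mem_image.1 hT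
      exact (hle i).trans le_self_add)
  have hint : ∀ i : Fin (M + 1), ∃ k, (g k).2 𝒜.γ = ((⌈t⌉₊ + i : ℕ) : ℝ≥0) := fun i =>
    hgS _ (Finset.mem_union_left _ (Finset.mem_image_of_mem (fun i => ((⌈t⌉₊ + i : ℕ) : ℝ≥0))
      (Finset.mem_range.2 i.2)))
  have hhalf : ∀ i : Fin (M + 1), ∃ k, (g k).2 𝒜.γ = ((⌈t⌉₊ + i : ℕ) : ℝ≥0) + 2⁻¹ := fun i =>
    hgS _ (Finset.mem_union_right _ (Finset.mem_image_of_mem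
      (fun i => ((⌈t⌉₊ + i : ℕ) : ℝ≥0) + 2⁻¹) (Finset.mem_range.2 i.2)))
  choose k hk using hint
  choose k' hk' using hhalf
  have := 𝒜.finite_reg
  have := Fintype.ofFinite 𝒜.Reg
  obtain ⟨i, j, hij, heq⟩ : ∃ i j : Fin (M + 1), i < j ∧ 𝒜.StateEquiv (g (k i)) (g (k j)) := by
    obtain ⟨i, j, hne, heq⟩ := Fintype.exists_ne_map_eq_of_card_lt
      (fun i : Fin (M + 1) => ((g (k i)).1, Quotient.mk 𝒜.clockSetoid (g (k i)).2) :
        Fin (M + 1) → L × 𝒜.Reg) (by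
      rw [Fintype.card_prod, Fintype.card_fin, ← Nat.card_eq_fintype_card (α := 𝒜.Reg)]
      omega)
    have hst : 𝒜.StateEquiv (g (k i)) (g (k j)) :=
      ⟨(Prod.mk.inj heq).1, Quotient.exact (Prod.mk.inj heq).2⟩
    rcases lt_or_gt_of_ne hne with h | h
    · exact ⟨i, j, h, hst⟩
    · exact ⟨j, i, h, hst.symm⟩
  have hmono := monotone_γ hg.step
  have h24 : k i ≤ k' i := by
    refine (hmono.reflect_lt (a := k i) (b := k' i) ?_).le
    rw [hk, hk']
    exact lt_add_of_pos_right _ (by positivity)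
  have h4K : k' i ≤ k j := by
    refine (hmono.reflect_lt (a := k' i) (b := k j) ?_).le
    rw [hk, hk']
    calc ((⌈t⌉₊ + i : ℕ) : ℝ≥0) + 2⁻¹ < ((⌈t⌉₊ + i : ℕ) : ℝ≥0) + 1 := by
          gcongr
          exact inv_lt_one_of_one_lt₀ one_lt_two
      _ ≤ ((⌈t⌉₊ + j : ℕ) : ℝ≥0) := by
          have : ⌈t⌉₊ + (i : ℕ) + 1 ≤ ⌈t⌉₊ + j := by
            have : (i : ℕ) < j := hij
            omega
          exact_mod_cast this
  refine ⟨g, hg, hg0, k i, k' i, k j, h24, h4K, heq, ⟨_, hk i⟩, ?_, fun n hn => hg.odd n ?_⟩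
  · rw [hk']
    exact not_isIntegerValue_add_half _
  · refine (hmono hn).trans_lt ?_
    change (g (k j)).2 𝒜.γ < (g 0).2 𝒜.γ + (lam : ℝ≥0)
    rw [hk, hg0]
    have h1 : (⌈t⌉₊ : ℝ≥0) < t + 1 := Nat.ceil_lt_add_one zero_le
    have h2 : 1 + (j : ℕ) ≤ lam := by omega
    have h3 : (1 : ℝ≥0) + (j : ℕ) ≤ lam := by exact_mod_cast h2
    calc ((⌈t⌉₊ + j : ℕ) : ℝ≥0) = (⌈t⌉₊ : ℝ≥0) + (j : ℕ) := by push_cast; rfl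
      _ < t + 1 + (j : ℕ) := by gcongr
      _ = t + (1 + (j : ℕ)) := add_assoc _ _ _
      _ ≤ t + lam := by gcongr

/-- A time-divergent path violating the fixed objective has, among its states at which a bad window
starts, one whose region recurs. The initial state is passed over, as it may violate its
invariant. -/
theorem InfPath.exists_isRecurrentBad [Fintype L] [Finite C] {𝒜 : TimedAutomaton L C A}
    {p : L → ℕ} {lam : ℕ} (π : 𝒜.InfPath) (hdiv : π.TimeDivergent)
    (hπ : π.state ∉ 𝒜.FTW p lam) :
    ∃ m, 𝒜.IsRecurrentBad p lam fun j => π.state (m + j) := by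
  have hstep : ∀ j, 𝒜.Step (π.state j) (π.state (j + 1)) := fun j => ⟨_, π.step j⟩
  have hmono := monotone_γ hstep
  have := 𝒜.finite_reg
  let Bad : ℕ → Prop := fun m => 1 ≤ m ∧ (fun k => π.state (m + k)) ∉ 𝒜.TGW p lam
  have hfreq : ∃ᶠ m in Filter.atTop, ∃ c : L × 𝒜.Reg, Bad m ∧
      ((π.state m).1, Quotient.mk 𝒜.clockSetoid (π.state m).2) = c := by
    rw [Filter.frequently_atTop]
    intro n
    obtain ⟨m, hm, hbad⟩ := notMem_FTW_iff.1 hπ (n + 1)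
    exact ⟨m, by omega, _, ⟨by omega, hbad⟩, rfl⟩
  obtain ⟨c, hc⟩ := Filter.frequently_exists.1 hfreq
  rw [Filter.frequently_atTop] at hc
  obtain ⟨m, -, ⟨hm, hbad⟩, hmc⟩ := hc 0
  refine ⟨m, fun j => hstep (m + j), fun j => ?_, fun T => ?_, notMem_TGW_iff.1 hbad, fun n => ?_⟩
  · obtain ⟨i, hi⟩ := Nat.exists_eq_add_of_le' (show 1 ≤ m + j by omega)
    simp only [hi]
    exact (hstep i).inv_sat
  · by_contra! hT
    refine hdiv ⟨T, ?_⟩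
    rintro _ ⟨j, rfl⟩
    exact (hmono (Nat.le_add_left j m)).trans (hT j)
  · obtain ⟨j, hj, -, hjc⟩ := hc (m + n)
    obtain ⟨i, rfl⟩ := Nat.exists_eq_add_of_le (show m ≤ j by omega)
    have h := hjc.trans hmc.symm
    exact ⟨i, by omega, (Prod.mk.inj h).1, Quotient.exact (Prod.mk.inj h).2⟩

end TimedAutomaton

/-! ### Equivalence of the three conditions -/

theorem mainTheorem8 {L C A : Type*} [Fintype L] [Fintype C] [Fintype A]
    (𝒜 : TimedAutomaton L C A) (p : L → ℕ) :
    List.TFAE [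
      ∃ π : 𝒜.InfPath, π.IsInitial ∧ π.TimeDivergent ∧ π.state ∉ 𝒜.BTW p,
      ∃ π : 𝒜.InfPath, π.IsInitial ∧ π.TimeDivergent ∧
        π.state ∉ 𝒜.FTW p (2 * Fintype.card L * Nat.card 𝒜.Reg + 3),
      ∃ s₁ s₂ s₂' s₃ s₄ : TimedState L C,
        𝒜.Reachable s₁ ∧ 𝒜.Reachable s₂ ∧ 𝒜.Reachable s₂' ∧ 𝒜.Reachable s₃ ∧ 𝒜.Reachable s₄ ∧
        𝒜.StateEquiv s₂ s₂' ∧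
        Xor (TimedAutomaton.IsIntegerValue (s₃.2 𝒜.γ)) (TimedAutomaton.IsIntegerValue (s₄.2 𝒜.γ)) ∧
        (∃ h : 𝒜.FinPath, h.state 0 = s₁ ∧ h.state (Fin.last h.length) = s₂' ∧
          (∃ i₂ i₃ i₄ : Fin (h.length + 1), i₂ ≤ i₃ ∧ i₃ ≤ i₄ ∧
            h.state i₂ = s₂ ∧ h.state i₃ = s₃ ∧ h.state i₄ = s₄) ∧
          ∀ i : Fin (h.length + 1), Odd (TimedAutomaton.minPriority p h.state i)) ∧
        𝒜.SetReachableFrom (𝒜.stateRegion s₁) s₂'] := by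
  tfae_have 1 → 2 := by
    rintro ⟨π, h0, hdiv, hπ⟩
    exact ⟨π, h0, hdiv, fun h => hπ ⟨_, h⟩⟩
  tfae_have 2 → 3 := by
    rintro ⟨π, h0, hdiv, hπ⟩
    obtain ⟨m, hm⟩ := π.exists_isRecurrentBad hdiv hπ
    obtain ⟨f, hf, hf0, i₂, i₄, K, h24, h4K, heq, hint, hnint, hodd⟩ := hm.exists_loop (by
      rw [mul_assoc]
      omega)
    have hrun : ∀ n, 𝒜.IsRun f n := fun n j _ => hf.step j
    have hreach₁ : 𝒜.Reachable (f 0) := by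
      rw [hf0, TimedAutomaton.Reachable, ← h0]
      exact TimedAutomaton.IsRun.setReachableFrom (n := m) (fun j _ => ⟨_, π.step j⟩) m.zero_le le_rfl
    have hreach : ∀ j, 𝒜.Reachable (f j) := fun j =>
      hreach₁.trans ((hrun j).setReachableFrom j.zero_le le_rfl)
    obtain ⟨h, rfl, hs⟩ := (hrun K).exists_finPath
    obtain ⟨j, hj, hj0⟩ := hf.recurrent h.length
    refine ⟨f 0, f i₂, f h.length, f i₂, f i₄, hreach _, hreach _, hreach _, hreach _, hreach _,
      heq, Or.inl ⟨hint, hnint⟩, ⟨h, hs 0, hs _, ⟨⟨i₂, by omega⟩, ⟨i₂, by omega⟩, ⟨i₄, by omega⟩,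
        le_rfl, h24, hs _, hs _, hs _⟩, fun i => ?_⟩, ?_⟩
    · exact (TimedAutomaton.odd_minPriority_fin_iff p (fun i => (hs i).symm) i).2 (hodd i (by omega))
    · obtain ⟨l, rfl⟩ := Nat.exists_eq_add_of_le hj
      exact TimedAutomaton.setReachableFrom_iff.2
        ⟨fun a => f (h.length + a), l, rfl, (hrun _).shift, hj0⟩
  tfae_have 3 → 1 := by
    rintro ⟨_, _, _, _, _, hreach, -, -, -, -, heq, hxor,
      ⟨h, rfl, rfl, ⟨i₂, i₃, i₄, h23, h34, rfl, rfl, rfl⟩, hodd⟩, hret⟩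
    simp only [← h.seq_val] at hreach heq hxor hret
    exact TimedAutomaton.exists_timeDivergent_notMem_BTW (i₂ := i₂) (i₃ := i₃) (i₄ := i₄) hreach h.isRun_seq h23
      h34 (Nat.lt_succ_iff.1 i₄.2) heq hxor
      (fun i hi => (TimedAutomaton.odd_minPriority_fin_iff p h.seq_val ⟨i, by omega⟩).1 (hodd _)) hret
  tfae_finish
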